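/- Let $H$ be a complex Hilbert space with an orthonormal basis $\{e_i : i\in\Theta\}$, where $\Theta$ is a countable (finite or infinite) set with at least two elements, and let $(\omega_i)_{i\in\Theta}$ be positive real numbers with $\sum_{i\in\Theta}\omega_i=1$. Let $\mathcal F(H)=\bigoplus_{n\ge 0}H^{\otimes n}$ be the full Fock space over $H$ (with $H^{\otimes 0}=\mathbb C\Omega$), let $l_i$ be the left creation operator on $\mathcal F(H)$ with $l_i\eta=e_i\otimes\eta$, and let $P_\omega$ be the normal unital completely positive map on $B(\mathcal F(H))$ given by $$P_\omega(x)=\sum_{i\in\Theta}\omega_i\,l_i^*\,x\,l_i .$$ For a map $\tau$ and $\lambda\in\mathbb C$ with $|\lambda|=1$ let $E_\lambda(\tau)=\{x:\tau(x)=\lambda x\}$, and let the peripheral Poisson boundary $P(\tau)$ be the norm closure of the linear span of $\bigcup_{|\lambda|=1}E_\lambda(\tau)$. There is a unique bounded bilinear product $\circ$ on $P(P_\omega)$ such that, for all $\lambda,\mu$ of modulus $1$, $x\in E_\lambda(P_\omega)$ and $y\in E_\mu(P_\omega)$, $$x\circ y=\operatorname{SOT-}\lim_{n\to\infty}(\lambda\mu)^{-n}P_\omega^n(xy).$$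 It is the modified Choi–Effros product: for every minimal dilation $(K,\mathcal B,\theta)$ of $P_\omega$, with $p$ the projection of $K$ onto $\mathcal F(H)$, the compression $T:z\mapsto pzp$ maps $P(\theta)$ isometrically and bijectively onto $P(P_\omega)$, and $x\circ y=T(T^{-1}(x)T^{-1}(y))$ for all $x,y\in P(P_\omega)$. Here a minimal dilation consists of a Hilbert space $K\supseteq\mathcal F(H)$, a von Neumann algebra $\mathcal B\subseteq B(K)$ containing $B(\mathcal F(H))=pB(K)p$, and a normal unital $*$-endomorphism $\theta$ of $\mathcal B$ such that $P_\omega^n(x)=p\,\theta^n(x)\,p$ for all $n\ge 0$ and $x\in B(\mathcal F(H))$, such that $\mathcal B$ is the von Neumann algebra generated by all $\theta^n(x)$, and such that the vectors $\theta^{n_1}(x_1)\cdots\theta^{n_k}(x_k)\xi$ with $k\ge 0$, $n_j\ge 0$, $x_j\in B(\mathcal F(H))$, $\xi\in\mathcal F(H)$ span a dense subspace of $K$. With this product, and with the norm, the involution and the unit of $B(\mathcal F(H))$, the space $P(P_\omega)$ is a unital C*-algebra. The center of the C*-algebra $(P(P_\omega),\circ)$ is trivial: an element $x\in P(P_\omega)$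 satisfies $x\circ y=y\circ x$ for all $y\in P(P_\omega)$ if and only if $x=c\,1$ for some $c\in\mathbb C$. -/

import Mathlib

open scoped TensorProduct InnerProduct lp

universe u v w

/-! ### The full Fock space -/

/-- A complex Hilbert space, bundled; used only to define the tensor powers by recursion. -/
structure BundledHilbert : Type (u + 1) where
  carrier : Type u
  [nacg : NormedAddCommGroup carrier]
  [ips : InnerProductSpace ℂ carrier]
  [complete : CompleteSpace carrier]

attribute [instance] BundledHilbert.nacg BundledHilbert.ips BundledHilbert.complete

/-- `H^{⊗ 0} = ℂ Ω` (one-dimensional), and `H^{⊗ (n+1)}` is the Hilbert space tensor product of `H`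
and `H^{⊗ n}`, that is, the completion of the algebraic tensor product for its inner product. -/
noncomputable def bundledTensorPower (H : Type u) [NormedAddCommGroup H]
    [InnerProductSpace ℂ H] : ℕ → BundledHilbert.{u}
  | 0 => ⟨EuclideanSpace ℂ PUnit.{u + 1}⟩
  | n + 1 => ⟨UniformSpace.Completion (H ⊗[ℂ] (bundledTensorPower H n).carrier)⟩

/-- The Hilbert space tensor power `H^{⊗ n}`. -/
abbrev HilbertTensorPower (H : Type u) [NormedAddCommGroup H] [InnerProductSpace ℂ H] (n : ℕ) :
    Type u :=
  (bundledTensorPower H n).carrier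

/-- The full Fock space: the Hilbert space direct sum of all `H^{⊗ n}`, `n ≥ 0`. -/
abbrev FullFock (H : Type u) [NormedAddCommGroup H] [InnerProductSpace ℂ H] : Type u :=
  lp (fun n : ℕ => HilbertTensorPower H n) 2

section Fock

variable {H : Type u} [NormedAddCommGroup H] [InnerProductSpace ℂ H]

/-- The elementary tensor `ξ ⊗ η` in `H^{⊗ (n+1)}`, for `ξ` in `H` and `η` in `H^{⊗ n}`. -/
noncomputable def tensorCons (ξ : H) {n : ℕ} (η : HilbertTensorPower H n) :
    HilbertTensorPower H (n + 1) :=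
  ((ξ ⊗ₜ[ℂ] η : H ⊗[ℂ] HilbertTensorPower H n) :
    UniformSpace.Completion (H ⊗[ℂ] HilbertTensorPower H n))

theorem tensorCons_add (ξ : H) {n : ℕ} (η η' : HilbertTensorPower H n) :
    tensorCons ξ (η + η') = tensorCons ξ η + tensorCons ξ η' := by
  unfold tensorCons
  rw [TensorProduct.tmul_add]
  exact UniformSpace.Completion.coe_add _ _

theorem tensorCons_smul (ξ : H) {n : ℕ} (c : ℂ) (η : HilbertTensorPower H n) :
    tensorCons ξ (c • η) = c • tensorCons ξ η := by
  unfold tensorCons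
  rw [TensorProduct.tmul_smul]
  exact UniformSpace.Completion.coe_smul c _

theorem norm_tensorCons (ξ : H) {n : ℕ} (η : HilbertTensorPower H n) :
    ‖tensorCons ξ η‖ = ‖ξ‖ * ‖η‖ := by
  unfold tensorCons
  refine (UniformSpace.Completion.norm_coe _).trans ?_
  exact TensorProduct.norm_tmul ξ η

/-- The components of `ξ ⊗ η`, for `ξ` in `H` and a family `η` with `η n` in `H^{⊗ n}`. -/
noncomputable def leftCreationFun (ξ : H) (η : ∀ n, HilbertTensorPower H n) :
    ∀ n, HilbertTensorPower H n
  | 0 => 0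
  | n + 1 => tensorCons ξ (η n)

theorem hasSum_leftCreationFun (ξ : H) (η : FullFock H) :
    HasSum (fun n => ‖leftCreationFun ξ (fun k => η k) n‖ ^ (2 : ℝ))
      ((‖ξ‖ * ‖η‖) ^ (2 : ℝ)) := by
  have h := lp.hasSum_norm (p := 2) (by norm_num) η
  simp only [ENNReal.toReal_ofNat] at h
  rw [← hasSum_nat_add_iff' 1]
  have h0 : ‖leftCreationFun ξ (fun k => η k) 0‖ = 0 := by simp [leftCreationFun]
  simp only [Finset.range_one, Finset.sum_singleton, h0]
  have h1 := h.mul_left (‖ξ‖ ^ (2 : ℝ))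
  simpa [leftCreationFun, norm_tensorCons, mul_pow] using h1

/-- The left creation operator `l_ξ`, given by `l_ξ η = ξ ⊗ η`. -/
noncomputable def leftCreation (ξ : H) : FullFock H →L[ℂ] FullFock H :=
  LinearMap.mkContinuous
    { toFun := fun η => ⟨leftCreationFun ξ (fun k => η k), by
        refine memℓp_gen ?_
        simpa using (hasSum_leftCreationFun ξ η).summable⟩
      map_add' := by
        intro η η'
        ext n
        cases n with
        | zero => exact (add_zero (0 : HilbertTensorPower H 0)).symm
        | succ n => exact tensorCons_add ξ (η n) (η' n)
      map_smul' := by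
        intro c η
        ext n
        cases n with
        | zero => exact (smul_zero c : c • (0 : HilbertTensorPower H 0) = 0).symm
        | succ n => exact tensorCons_smul ξ c (η n) }
    ‖ξ‖ (by
      intro η
      refine lp.norm_le_of_tsum_le (p := 2) (by norm_num) (by positivity) ?_
      simpa using (hasSum_leftCreationFun ξ η).tsum_eq.le)

/-- The map `P_ω x = ∑ ω_i l_{e_i}^* x l_{e_i}` on `B(F(H))`. -/
noncomputable def fockUCP {Θ : Type v} (e : HilbertBasis Θ ℂ H) (ω : Θ → ℝ)
    (x : FullFock H →L[ℂ] FullFock H) : FullFock H →L[ℂ] FullFock H :=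
  ∑' i, (ω i : ℂ) •
    ((leftCreation (e i)).adjoint ∘L x ∘L leftCreation (e i))

end Fock

/-! ### The peripheral Poisson boundary -/

/-- The union over all `λ` on the unit circle of the spaces `E_λ(τ) = {x | τ x = λ x}`. -/
def peripheralEigenvectors {A : Type u} [SMul ℂ A] (τ : A → A) : Set A :=
  {x | ∃ c : ℂ, ‖c‖ = 1 ∧ τ x = c • x}

/-- The peripheral Poisson boundary `P(τ)`: the norm closed span of the peripheral eigenvectors. -/
noncomputable def peripheralPoissonBoundary {A : Type u} [NormedRing A] [NormedAlgebra ℂ A] (τ : A → A) :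
    Submodule ℂ A :=
  (Submodule.span ℂ (peripheralEigenvectors τ)).topologicalClosure

section Product

variable {F : Type u} [NormedAddCommGroup F] [InnerProductSpace ℂ F] [CompleteSpace F]

/-- `m` is a bounded bilinear operation on `P(τ)` which extends the modified Choi-Effros product:
for `x ∈ E_λ(τ)` and `y ∈ E_μ(τ)`,
`m x y` is the limit of `(λ μ)^{-n} τ^n(x y)` in the strong operator topology. -/
def IsModifiedChoiEffrosProduct (τ : (F →L[ℂ] F) → (F →L[ℂ] F))
    (m : peripheralPoissonBoundary τ →L[ℂ]
      peripheralPoissonBoundary τ →L[ℂ] peripheralPoissonBoundary τ) : Prop :=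
  ∀ (c d : ℂ) (x y : peripheralPoissonBoundary τ), ‖c‖ = 1 → ‖d‖ = 1 →
    τ (x : F →L[ℂ] F) = c • (x : F →L[ℂ] F) → τ (y : F →L[ℂ] F) = d • (y : F →L[ℂ] F) →
    ∀ ξ : F, Filter.Tendsto
      (fun n : ℕ => ((c * d) ^ n)⁻¹ • (τ^[n] ((x : F →L[ℂ] F) * (y : F →L[ℂ] F))) ξ)
      Filter.atTop (nhds ((m x y : F →L[ℂ] F) ξ))

/-- `(S, m)` is a unital C*-algebra for the norm, the involution and the unit of the C*-algebra `A`
in which `S` is a closed subspace. -/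
structure IsUnitalCStarProduct {A : Type u} [CStarAlgebra A] (S : Submodule ℂ A)
    (m : S →L[ℂ] S →L[ℂ] S) : Prop where
  isClosed : IsClosed (S : Set A)
  assoc : ∀ x y z : S, m (m x y) z = m x (m y z)
  exists_one : ∃ one : S, (one : A) = 1 ∧ ∀ x : S, m one x = x ∧ m x one = x
  norm_mul_le : ∀ x y : S, ‖m x y‖ ≤ ‖x‖ * ‖y‖
  star_mem : ∀ x ∈ S, star x ∈ S
  star_mul : ∀ x y : S,
    star (m x y : A) = (m ⟨star (y : A), star_mem y y.2⟩ ⟨star (x : A), star_mem x x.2⟩ : A)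
  norm_star_mul_self : ∀ x : S, ‖m ⟨star (x : A), star_mem x x.2⟩ x‖ = ‖x‖ ^ 2

/-- A minimal dilation `(K, B, θ)` of a map `τ` on `B(F)`, where `F` is regarded as a closed
subspace of `K` through the isometry `V`, and `B(F)` as a corner of `B(K)` through
`x ↦ V x V^*`. -/
structure MinimalDilation (τ : (F →L[ℂ] F) → (F →L[ℂ] F)) (K : Type w) [NormedAddCommGroup K]
    [InnerProductSpace ℂ K] [CompleteSpace K] where
  V : F →ₗᵢ[ℂ] K
  B : VonNeumannAlgebra K
  θ : B.toStarSubalgebra →⋆ₐ[ℂ] B.toStarSubalgebra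
  /-- `θ` is normal: it preserves suprema of bounded increasing nets of positive operators. -/
  normal : ∀ (D : Set B.toStarSubalgebra) (s : B.toStarSubalgebra), D.Nonempty →
    DirectedOn (fun a b : B.toStarSubalgebra => (a : K →L[ℂ] K) ≤ (b : K →L[ℂ] K)) D →
    (∀ a ∈ D, 0 ≤ (a : K →L[ℂ] K)) →
    IsLUB ((fun a : B.toStarSubalgebra => (a : K →L[ℂ] K)) '' D) (s : K →L[ℂ] K) →
    IsLUB ((fun a : B.toStarSubalgebra => (θ a : K →L[ℂ] K)) '' D) (θ s : K →L[ℂ] K)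
  corner_mem : ∀ x : F →L[ℂ] F,
    V.toContinuousLinearMap ∘L x ∘L V.toContinuousLinearMap.adjoint ∈ B.toStarSubalgebra
  /-- `τ^n(x) = p θ^n(x) p`, where `p` is the projection of `K` onto `F`. -/
  dilates : ∀ (n : ℕ) (x : F →L[ℂ] F), τ^[n] x = V.toContinuousLinearMap.adjoint ∘L
    (θ^[n] ⟨_, corner_mem x⟩ : K →L[ℂ] K) ∘L V.toContinuousLinearMap
  /-- `B` is the von Neumann algebra generated by all `θ^n(x)`. -/
  generated : ∀ C : VonNeumannAlgebra K,
    (∀ (n : ℕ) (x : F →L[ℂ] F), (θ^[n] ⟨_, corner_mem x⟩ : K →L[ℂ] K) ∈ C) → B ≤ C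
  /-- The vectors `θ^{n_1}(x_1) ⋯ θ^{n_k}(x_k) ξ`, `ξ ∈ F`, span a dense subspace of `K`. -/
  cyclic : (Submodule.span ℂ {ζ : K | ∃ (s : List (ℕ × (F →L[ℂ] F))) (ξ : F),
    ζ = (s.map fun q => (θ^[q.1] ⟨_, corner_mem q.2⟩ : K →L[ℂ] K)).prod (V ξ)}).topologicalClosure
      = ⊤

/-- The compression `z ↦ p z p` of a dilation, as a map from `B` to `B(F)`. -/
noncomputable def MinimalDilation.compression {τ : (F →L[ℂ] F) → (F →L[ℂ] F)} {K : Type w}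
    [NormedAddCommGroup K] [InnerProductSpace ℂ K] [CompleteSpace K] (D : MinimalDilation τ K)
    (z : D.B.toStarSubalgebra) : F →L[ℂ] F :=
  D.V.toContinuousLinearMap.adjoint ∘L (z : K →L[ℂ] K) ∘L D.V.toContinuousLinearMap

end Product

/-! ### The basis of words in the full Fock space -/

section FockBasis

variable {H : Type u} [NormedAddCommGroup H] [InnerProductSpace ℂ H]

/-! Write τ for the map P_ω. Fix an idempotent ultrafilter V on ℕ and let Φ(x) be the weak operator
limit of τ^n(x) along V. Idempotence makes limits along V agree with iterated limits. Hence c^n → 1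
along V for every |c| = 1, so Φ fixes all peripheral eigenvectors and therefore P(τ); by normality
of τ also Φ² = Φ. Thus Φ is a Schwarz projection, and x ∘ y = Φ(xy) for all eigenvalues at once
(`ultraLimit_mul_eigenvectors`). The Choi-Effros identity `ultraLimit_star_mul` gives associativity,
and the Schwarz inequality gives the C*-identity.

That the product stays in P(τ) needs the normalized strong limits to exist. The gauge unitaries U_c,
with U_c l_i = c l_i U_c, turn eigenvectors into fixed points. For a fixed point h the sequence
τ^n(h^*h) is increasing and bounded, and polarization does the rest
(`hasPeripheralLimits_isometryAverage`).

For a minimal dilation, the projections p_n = θ^n(p) increase strongly to 1, and p_n θ^n(z) p_n =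
θ^n(pzp). This recovers z from its compression, and so gives isometry, lifting of eigenvectors and
the product formula.

For the center, an operator B with B l_i = d l_i B and |d| = 1 is an eigenvector, and Φ(xB) = Φ(x)B.
This covers the U_c and the right creation operators r_j. A central x commutes with every U_c, so it
preserves word length, and r_k^* x r_j = Φ(r_k^* r_j x) = δ_{kj} x. Removing last letters reduces
every matrix coefficient of x to the vacuum one (`eq_smul_one_of_gauge_invariant`). -/

theorem leftCreation_apply_zero (ξ : H) (η : FullFock H) : leftCreation ξ η 0 = 0 := rfl

theorem leftCreation_apply_succ (ξ : H) (η : FullFock H) (n : ℕ) :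
    leftCreation ξ η (n + 1) = tensorCons ξ (η n) := rfl

theorem inner_tensorCons (ξ ξ' : H) {n : ℕ} (η η' : HilbertTensorPower H n) :
    inner ℂ (tensorCons ξ η) (tensorCons ξ' η') = inner ℂ ξ ξ' * inner ℂ η η' := by
  unfold tensorCons
  exact (UniformSpace.Completion.inner_coe _ _).trans (TensorProduct.inner_tmul _ _ _ _ _)

theorem add_tensorCons (ξ ξ' : H) {n : ℕ} (η : HilbertTensorPower H n) :
    tensorCons (ξ + ξ') η = tensorCons ξ η + tensorCons ξ' η := by
  unfold tensorCons
  rw [TensorProduct.add_tmul]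
  exact UniformSpace.Completion.coe_add _ _

theorem smul_tensorCons (c : ℂ) (ξ : H) {n : ℕ} (η : HilbertTensorPower H n) :
    tensorCons (c • ξ) η = c • tensorCons ξ η := by
  unfold tensorCons
  rw [← TensorProduct.smul_tmul']
  exact UniformSpace.Completion.coe_smul c _

theorem inner_leftCreation (ξ ξ' : H) (η η' : FullFock H) :
    inner ℂ (leftCreation ξ η) (leftCreation ξ' η') = inner ℂ ξ ξ' * inner ℂ η η' := by
  have h := lp.hasSum_inner (𝕜 := ℂ) (leftCreation ξ η) (leftCreation ξ' η')
  rw [← hasSum_nat_add_iff' 1] at h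
  simp only [leftCreation_apply_succ, inner_tensorCons, Finset.range_one, Finset.sum_singleton,
    leftCreation_apply_zero, inner_zero_left, sub_zero] at h
  exact h.unique ((lp.hasSum_inner (𝕜 := ℂ) η η').mul_left _)

theorem norm_leftCreation_apply (ξ : H) (η : FullFock H) :
    ‖leftCreation ξ η‖ = ‖ξ‖ * ‖η‖ := by
  have h := inner_leftCreation ξ ξ η η
  rw [inner_self_eq_norm_sq_to_K, inner_self_eq_norm_sq_to_K, inner_self_eq_norm_sq_to_K,
    ← mul_pow] at h
  have h' : ‖leftCreation ξ η‖ ^ 2 = (‖ξ‖ * ‖η‖) ^ 2 := by exact_mod_cast h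
  exact (pow_left_inj₀ (norm_nonneg _) (by positivity) two_ne_zero).1 h'

theorem leftCreation_single (ξ : H) (n : ℕ) (η : HilbertTensorPower H n) :
    leftCreation ξ (lp.single 2 n η) = lp.single 2 (n + 1) (tensorCons ξ η) := by
  ext k
  rcases k with _ | k
  · rw [leftCreation_apply_zero, lp.single_apply_ne _ _ _ (Nat.succ_ne_zero n).symm]
  · rw [leftCreation_apply_succ]
    by_cases h : k = n
    · subst h
      rw [lp.single_apply_self, lp.single_apply_self]
    · rw [lp.single_apply_ne _ _ _ h, lp.single_apply_ne _ _ _ (by omega)]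
      -- Homogeneity with scalar 0 yields ξ ⊗ 0 = 0.
      simpa using tensorCons_smul ξ 0 (0 : HilbertTensorPower H k)

/-- The map `ξ ↦ l_ξ ζ`, for a fixed vector `ζ`. -/
noncomputable def leftCreationFlip (ζ : FullFock H) : H →L[ℂ] FullFock H :=
  LinearMap.mkContinuous
    { toFun := fun ξ => leftCreation ξ ζ
      map_add' := by
        intro ξ ξ'
        ext n
        cases n with
        | zero => exact (add_zero (0 : HilbertTensorPower H 0)).symm
        | succ n => exact add_tensorCons ξ ξ' (ζ n)
      map_smul' := by
        intro c ξ
        ext n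
        cases n with
        | zero => exact (smul_zero c : c • (0 : HilbertTensorPower H 0) = 0).symm
        | succ n => exact smul_tensorCons c ξ (ζ n) }
    ‖ζ‖ (by
      intro ξ
      exact (norm_leftCreation_apply ξ ζ).le.trans (mul_comm _ _).le)

/-- The vacuum vector `Ω`. -/
noncomputable def fockVacuum (H : Type u) [NormedAddCommGroup H] [InnerProductSpace ℂ H] :
    FullFock H :=
  lp.single 2 0 (show HilbertTensorPower H 0 from EuclideanSpace.single PUnit.unit (1 : ℂ))

theorem inner_fockVacuum_self : inner ℂ (fockVacuum H) (fockVacuum H) = 1 := by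
  unfold fockVacuum
  rw [lp.inner_single_left, lp.single_apply_self]
  have h : inner ℂ (EuclideanSpace.single PUnit.unit.{u + 1} (1 : ℂ))
      (EuclideanSpace.single PUnit.unit (1 : ℂ)) = 1 := by
    simp
  exact h

theorem inner_fockVacuum_leftCreation (ξ : H) (η : FullFock H) :
    inner ℂ (fockVacuum H) (leftCreation ξ η) = 0 := by
  unfold fockVacuum
  rw [lp.inner_single_left, leftCreation_apply_zero, inner_zero_right]

variable {Θ : Type v} (e : HilbertBasis Θ ℂ H)

/-- The vector `e_{i_1} ⊗ ⋯ ⊗ e_{i_n}` of the word `i_1 ⋯ i_n`. -/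
noncomputable def fockWord : List Θ → FullFock H
  | [] => fockVacuum H
  | i :: w => leftCreation (e i) (fockWord w)

theorem orthonormal_fockWord : Orthonormal ℂ (fockWord e) := by
  classical
  rw [orthonormal_iff_ite]
  intro a
  induction a with
  | nil =>
    rintro (_ | ⟨j, b⟩)
    · rw [if_pos rfl]
      exact inner_fockVacuum_self
    · rw [if_neg (by simp)]
      exact inner_fockVacuum_leftCreation _ _
  | cons i a ih =>
    rintro (_ | ⟨j, b⟩)
    · rw [if_neg (by simp), ← inner_conj_symm]
      exact (congrArg _ (inner_fockVacuum_leftCreation _ _)).trans (map_zero _)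
    · have h := orthonormal_iff_ite.1 e.orthonormal i j
      simp only [fockWord, inner_leftCreation, h, ih, List.cons.injEq]
      split_ifs <;> simp_all

/-- The vector l_ξ ζ is linear and continuous in each variable separately: approximate ζ by words
while ξ is a basis vector, then approximate ξ. -/
theorem leftCreation_mem_closure_span (ξ : H) {ζ : FullFock H}
    (hζ : ζ ∈ (Submodule.span ℂ (Set.range (fockWord e))).topologicalClosure) :
    leftCreation ξ ζ ∈ (Submodule.span ℂ (Set.range (fockWord e))).topologicalClosure := by
  set S := (Submodule.span ℂ (Set.range (fockWord e))).topologicalClosure with hS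
  have hi : ∀ i, leftCreation (e i) ζ ∈ S := by
    intro i
    have : (Submodule.span ℂ (Set.range (fockWord e))).topologicalClosure ≤
        S.comap (leftCreation (e i)).toLinearMap := by
      refine Submodule.topologicalClosure_minimal _ (Submodule.span_le.2 ?_) ?_
      · rintro _ ⟨w, rfl⟩
        exact Submodule.le_topologicalClosure _ (Submodule.subset_span ⟨i :: w, rfl⟩)
      · exact (Submodule.isClosed_topologicalClosure _).preimage (leftCreation (e i)).continuous
    exact this hζ
  have : (Submodule.span ℂ (Set.range e)).topologicalClosure ≤
      S.comap (leftCreationFlip ζ).toLinearMap := by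
    refine Submodule.topologicalClosure_minimal _ (Submodule.span_le.2 ?_) ?_
    · rintro _ ⟨i, rfl⟩
      exact hi i
    · exact (Submodule.isClosed_topologicalClosure _).preimage (leftCreationFlip ζ).continuous
  rw [e.dense_span] at this
  exact this (Submodule.mem_top (x := ξ))

/-- Induction on the tensor degree: finite sums of elementary tensors ξ ⊗ η are dense in the
completion, and each of them is l_ξ applied to a vector of lower degree. -/
theorem single_mem_closure_span (n : ℕ) (η : HilbertTensorPower H n) :
    lp.single 2 n η ∈ (Submodule.span ℂ (Set.range (fockWord e))).topologicalClosure := by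
  induction n with
  | zero =>
    have h : η = (show EuclideanSpace ℂ PUnit.{u + 1} from η) PUnit.unit •
        (show HilbertTensorPower H 0 from EuclideanSpace.single PUnit.unit (1 : ℂ)) := by
      change (show EuclideanSpace ℂ PUnit.{u + 1} from η) =
        (show EuclideanSpace ℂ PUnit.{u + 1} from η) PUnit.unit •
          EuclideanSpace.single PUnit.unit (1 : ℂ)
      ext i
      simp
    rw [h, lp.single_smul]
    exact Submodule.smul_mem _ _
      (Submodule.le_topologicalClosure _ (Submodule.subset_span ⟨[], rfl⟩))
  | succ n ih =>
    have hc : Continuous fun η : HilbertTensorPower H (n + 1) =>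
        (lp.single 2 (n + 1) η : FullFock H) := (lp.isometry_single (n + 1)).continuous
    refine UniformSpace.Completion.induction_on
      (α := H ⊗[ℂ] HilbertTensorPower H n) (p := fun η =>
        (lp.single 2 (n + 1) (show HilbertTensorPower H (n + 1) from η) : FullFock H) ∈
        (Submodule.span ℂ (Set.range (fockWord e))).topologicalClosure) η ?_ ?_
    · exact (Submodule.isClosed_topologicalClosure _).preimage hc
    · intro a
      induction a with
      | zero =>
        have h0 : (lp.single 2 (n + 1) (0 : HilbertTensorPower H (n + 1)) : FullFock H) ∈
          (Submodule.span ℂ (Set.range (fockWord e))).topologicalClosure := by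
          rw [lp.single_zero]
          exact Submodule.zero_mem _
        exact (congrArg (fun t : HilbertTensorPower H (n + 1) =>
          (lp.single 2 (n + 1) t : FullFock H) ∈ _) (UniformSpace.Completion.coe_zero
            (α := H ⊗[ℂ] HilbertTensorPower H n))).mpr h0
      | tmul ξ η =>
        have := leftCreation_mem_closure_span e ξ (ih η)
        rwa [leftCreation_single] at this
      | add a b ha hb =>
        have := Submodule.add_mem _ ha hb
        rw [← lp.single_add] at this
        exact (congrArg (fun t : HilbertTensorPower H (n + 1) =>
          (lp.single 2 (n + 1) t : FullFock H) ∈ _) (UniformSpace.Completion.coe_add a b)).mpr this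

theorem closure_span_fockWord :
    (Submodule.span ℂ (Set.range (fockWord e))).topologicalClosure = ⊤ := by
  refine eq_top_iff.2 fun ζ _ => ?_
  have h := lp.hasSum_single (p := 2) (by norm_num) ζ
  exact (Submodule.isClosed_topologicalClosure _).mem_of_tendsto h
    (Filter.Eventually.of_forall fun s => Submodule.sum_mem _ fun n _ =>
      single_mem_closure_span e n (ζ n))

/-- The orthonormal basis of the full Fock space that consists of the words. -/
noncomputable def fockBasis : HilbertBasis (List Θ) ℂ (FullFock H) :=
  HilbertBasis.mk (orthonormal_fockWord e) (closure_span_fockWord e).ge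

theorem fockBasis_apply (w : List Θ) : fockBasis e w = fockWord e w := by
  simp [fockBasis]

theorem leftCreation_fockBasis (i : Θ) (w : List Θ) :
    leftCreation (e i) (fockBasis e w) = fockBasis e (i :: w) := by
  simp [fockBasis_apply, fockWord]

end FockBasis

/-! ### Idempotent ultrafilters on the natural numbers -/

section IdempotentUltrafilter

attribute [local instance] Ultrafilter.add Ultrafilter.addSemigroup

/-- This is the Ellis-Numakura lemma for ultrafilters. It is applied over ℕ+ because over ℕ the
principal ultrafilter at 0 is idempotent and would be useless. -/
theorem exists_idempotent_ultrafilter_nat : ∃ V : Ultrafilter ℕ, (V : Filter ℕ) ≤ Filter.atTop ∧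
    ∀ p : ℕ → Prop, (∀ᶠ n in (V : Filter ℕ), p n) →
      ∀ᶠ n in (V : Filter ℕ), ∀ᶠ k in (V : Filter ℕ), p (n + k) := by
  obtain ⟨U, hU⟩ := exists_idempotent_of_compact_t2_of_continuous_add_left
    (M := Ultrafilter ℕ+) Ultrafilter.continuous_add_left
  have hp : ∀ p : ℕ+ → Prop, (∀ᶠ n in (U : Filter ℕ+), p n) ↔
      ∀ᶠ n in (U : Filter ℕ+), ∀ᶠ k in (U : Filter ℕ+), p (n + k) := by
    intro p
    rw [← Ultrafilter.eventually_add, hU]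
  refine ⟨U.map (fun n : ℕ+ => (n : ℕ)), ?_, ?_⟩
  · rcases U.le_cofinite_or_eq_pure with h | ⟨a, rfl⟩
    · rw [← Nat.cofinite_eq_atTop]
      exact (Filter.map_mono h).trans (PNat.coe_injective.tendsto_cofinite)
    -- A principal idempotent at `a` would force a + a = a.
    · have h := (hp (fun n => n = a)).1 (by simp)
      simp only [Ultrafilter.coe_pure, Filter.eventually_pure] at h
      have h' := congrArg PNat.val h
      have := a.pos
      simp at h'
  · intro p h
    simp only [Ultrafilter.coe_map, Filter.eventually_map] at h ⊢
    have := (hp fun n => p n).1 h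
    simpa using this

variable {V : Ultrafilter ℕ}

/-- Limits along an idempotent ultrafilter agree with iterated limits. -/
theorem eq_of_tendsto_idempotent {X : Type*} [TopologicalSpace X] [T2Space X] [RegularSpace X]
    (hV : ∀ p : ℕ → Prop, (∀ᶠ n in (V : Filter ℕ), p n) →
      ∀ᶠ n in (V : Filter ℕ), ∀ᶠ k in (V : Filter ℕ), p (n + k))
    {f g : ℕ → X} {a b : X} (hf : Filter.Tendsto f V (nhds a))
    (hg : ∀ n, Filter.Tendsto (fun k => f (n + k)) V (nhds (g n)))
    (hb : Filter.Tendsto g V (nhds b)) : b = a := by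
  by_contra hne
  -- The neighbourhood of `a` avoiding `b` must be closed, so that membership survives both the
  -- inner and the outer limit.
  obtain ⟨s, ⟨hs, hsc⟩, hsb⟩ := (closed_nhds_basis a).mem_iff.1
    (isOpen_compl_singleton.mem_nhds (Ne.symm hne) : {b}ᶜ ∈ nhds a)
  have h1 := hV (fun n => f n ∈ s) (hf hs)
  have h2 : ∀ᶠ n in (V : Filter ℕ), g n ∈ s :=
    h1.mono fun n hn => hsc.mem_of_tendsto (hg n) hn
  exact hsb (hsc.mem_of_tendsto hb h2) rfl

/-- The limit exists by compactness of the circle and, as an iterated limit, satisfies a · a = a;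
being nonzero, it is 1. So one ultrafilter serves all peripheral eigenvalues. -/
theorem tendsto_pow_idempotent
    (hV : ∀ p : ℕ → Prop, (∀ᶠ n in (V : Filter ℕ), p n) →
      ∀ᶠ n in (V : Filter ℕ), ∀ᶠ k in (V : Filter ℕ), p (n + k))
    {c : ℂ} (hc : ‖c‖ = 1) : Filter.Tendsto (fun n => c ^ n) V (nhds 1) := by
  obtain ⟨a, ha, hVa⟩ := (isCompact_sphere (0 : ℂ) 1).ultrafilter_le_nhds
    (V.map fun n => c ^ n) (by
      rw [Filter.le_principal_iff]
      exact Filter.mem_map.2 (Filter.univ_mem' fun n => by simp [hc]))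
  have h1 : Filter.Tendsto (fun n => c ^ n) V (nhds a) := hVa
  have ha0 : a ≠ 0 := by
    rintro rfl
    simp at ha
  have h2 : a * a = a := eq_of_tendsto_idempotent hV (g := fun n => c ^ n * a) h1
    (fun n => by simpa only [pow_add] using h1.const_mul (c ^ n)) (h1.mul_const a)
  have h3 : a = 1 := by simpa [ha0] using h2
  rwa [h3] at h1

end IdempotentUltrafilter

/-! ### Convergence in the weak operator topology -/

section WeakOperator

variable {F : Type u} [NormedAddCommGroup F] [InnerProductSpace ℂ F]

/-- Convergence in the weak operator topology. -/
def TendstoWOT {ι : Type*} (T : ι → F →L[ℂ] F) (l : Filter ι) (S : F →L[ℂ] F) : Prop :=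
  ∀ ξ η : F, Filter.Tendsto (fun n => inner ℂ η (T n ξ)) l (nhds (inner ℂ η (S ξ)))

namespace TendstoWOT

variable {ι : Type*} {T T' : ι → F →L[ℂ] F} {l : Filter ι} {S S' : F →L[ℂ] F}

theorem of_strong (h : ∀ ξ, Filter.Tendsto (fun n => T n ξ) l (nhds (S ξ))) :
    TendstoWOT T l S :=
  fun ξ _ => tendsto_const_nhds.inner (h ξ)

theorem const (S : F →L[ℂ] F) : TendstoWOT (fun _ : ι => S) l S :=
  fun _ _ => tendsto_const_nhds

theorem unique [l.NeBot] (h : TendstoWOT T l S) (h' : TendstoWOT T l S') : S = S' := by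
  ext ξ
  exact ext_inner_left ℂ fun η => tendsto_nhds_unique (h ξ η) (h' ξ η)

theorem add (h : TendstoWOT T l S) (h' : TendstoWOT T' l S') :
    TendstoWOT (fun n => T n + T' n) l (S + S') := by
  intro ξ η
  simpa only [add_apply, inner_add_right] using (h ξ η).add (h' ξ η)

theorem sub (h : TendstoWOT T l S) (h' : TendstoWOT T' l S') :
    TendstoWOT (fun n => T n - T' n) l (S - S') := by
  intro ξ η
  simpa only [sub_apply, inner_sub_right] using (h ξ η).sub (h' ξ η)

theorem smul {c : ι → ℂ} {a : ℂ} (hc : Filter.Tendsto c l (nhds a)) (h : TendstoWOT T l S) :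
    TendstoWOT (fun n => c n • T n) l (a • S) := by
  intro ξ η
  simpa only [smul_apply, inner_smul_right] using hc.mul (h ξ η)

theorem mul_const (h : TendstoWOT T l S) (A : F →L[ℂ] F) :
    TendstoWOT (fun n => T n * A) l (S * A) :=
  fun ξ η => h (A ξ) η

theorem const_mul [CompleteSpace F] (h : TendstoWOT T l S) (A : F →L[ℂ] F) :
    TendstoWOT (fun n => A * T n) l (A * S) := by
  intro ξ η
  simpa only [mul_apply_eq_comp, ContinuousLinearMap.adjoint_inner_left] using
    h ξ (A.adjoint η)

theorem star [CompleteSpace F] (h : TendstoWOT T l S) :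
    TendstoWOT (fun n => star (T n)) l (star S) := by
  intro ξ η
  have := (Complex.continuous_conj.tendsto _).comp (h η ξ)
  simpa only [Function.comp_def, inner_conj_symm, ContinuousLinearMap.star_eq_adjoint,
    ContinuousLinearMap.adjoint_inner_right] using this

theorem norm_le [l.NeBot] (h : TendstoWOT T l S) {C : ℝ} (hT : ∀ n, ‖T n‖ ≤ C) : ‖S‖ ≤ C := by
  have hC : 0 ≤ C := by
    obtain ⟨n, -⟩ := l.nonempty_of_mem Filter.univ_mem
    exact (norm_nonneg _).trans (hT n)
  refine S.opNorm_le_bound hC fun ξ => ?_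
  have h1 : ‖inner ℂ (S ξ) (S ξ)‖ ≤ ‖S ξ‖ * (C * ‖ξ‖) :=
    le_of_tendsto (h ξ (S ξ)).norm (Filter.Eventually.of_forall fun n =>
      (norm_inner_le_norm _ _).trans (by gcongr; exact (T n).le_of_opNorm_le (hT n) ξ))
  rw [inner_self_eq_norm_sq_to_K, norm_pow] at h1
  simp only [Complex.coe_algebraMap, Complex.norm_real, norm_norm] at h1
  rcases (norm_nonneg (S ξ)).eq_or_lt with h0 | h0
  · rw [← h0]
    positivity
  · rw [pow_two] at h1
    exact le_of_mul_le_mul_left h1 h0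

theorem nonneg [l.NeBot] (h : TendstoWOT T l S) (hT : ∀ᶠ n in l, 0 ≤ T n) : 0 ≤ S := by
  rw [ContinuousLinearMap.nonneg_iff_isPositive, ContinuousLinearMap.isPositive_iff_complex]
  intro ξ
  have h1 : ∀ᶠ n in l, 0 ≤ (inner ℂ ξ (T n ξ)).re ∧ (inner ℂ ξ (T n ξ)).im = 0 := by
    filter_upwards [hT] with n hn
    have h2 := ((ContinuousLinearMap.nonneg_iff_isPositive _).1 hn).inner_nonneg_right ξ
    exact ⟨(Complex.le_def.1 h2).1, (Complex.le_def.1 h2).2.symm⟩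
  have hre : 0 ≤ (inner ℂ ξ (S ξ)).re :=
    ge_of_tendsto ((Complex.continuous_re.tendsto _).comp (h ξ ξ))
      (h1.mono fun n hn => hn.1)
  have him : (inner ℂ ξ (S ξ)).im = 0 :=
    tendsto_nhds_unique ((Complex.continuous_im.tendsto _).comp (h ξ ξ))
      (tendsto_const_nhds.congr' (h1.mono fun n hn => hn.2.symm))
  have hre' : (inner ℂ (S ξ) ξ).re = (inner ℂ ξ (S ξ)).re := inner_re_symm (𝕜 := ℂ) _ _
  have him' : (inner ℂ (S ξ) ξ).im = -(inner ℂ ξ (S ξ)).im := inner_im_symm (𝕜 := ℂ) _ _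
  refine ⟨Complex.ext ?_ ?_, ?_⟩ <;> simp [him, hre, hre', him']

end TendstoWOT

/-- Weak operator compactness of balls: the matrix coefficients converge along the ultrafilter, and
their limits form a bounded sesquilinear form, which is represented by an operator. -/
theorem exists_tendstoWOT [CompleteSpace F] {ι : Type*} (U : Ultrafilter ι) (T : ι → F →L[ℂ] F)
    {C : ℝ} (hT : ∀ n, ‖T n‖ ≤ C) : ∃ S, TendstoWOT T U S := by
  have hb : ∀ ξ η n, ‖inner ℂ η (T n ξ)‖ ≤ C * ‖η‖ * ‖ξ‖ := by
    intro ξ η n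
    calc ‖inner ℂ η (T n ξ)‖ ≤ ‖η‖ * (C * ‖ξ‖) := (norm_inner_le_norm _ _).trans
          (by gcongr; exact (T n).le_of_opNorm_le (hT n) ξ)
      _ = C * ‖η‖ * ‖ξ‖ := by ring
  have hlim : ∀ ξ η, ∃ a : ℂ, Filter.Tendsto (fun n => inner ℂ η (T n ξ)) U (nhds a) := by
    intro ξ η
    obtain ⟨a, -, ha⟩ := (isCompact_closedBall (0 : ℂ) (C * ‖η‖ * ‖ξ‖)).ultrafilter_le_nhds
      (U.map fun n => inner ℂ η (T n ξ)) (by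
        rw [Filter.le_principal_iff]
        exact Filter.mem_map.2 (Filter.univ_mem' fun n => by simpa using hb ξ η n))
    exact ⟨a, ha⟩
  choose f hf using hlim
  let B : F →L⋆[ℂ] F →L[ℂ] ℂ := LinearMap.mkContinuous₂
    (LinearMap.mk₂'ₛₗ (starRingEnd ℂ) (RingHom.id ℂ) (fun η ξ => f ξ η)
      (fun η η' ξ => tendsto_nhds_unique (hf ξ (η + η'))
        (by simpa only [inner_add_left] using (hf ξ η).add (hf ξ η')))
      (fun c η ξ => tendsto_nhds_unique (hf ξ (c • η))
        (by simpa only [inner_smul_left, smul_eq_mul] using (hf ξ η).const_mul _))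
      (fun η ξ ξ' => tendsto_nhds_unique (hf (ξ + ξ') η)
        (by simpa only [map_add, inner_add_right] using (hf ξ η).add (hf ξ' η)))
      (fun c η ξ => tendsto_nhds_unique (hf (c • ξ) η)
        (by simpa only [map_smul, inner_smul_right, smul_eq_mul, RingHom.id_apply] using
          (hf ξ η).const_mul c)))
    C (fun η ξ => le_of_tendsto (hf ξ η).norm (Filter.Eventually.of_forall (hb ξ η)))
  -- The representing operator acts on the conjugate-linear argument η, so the limit is its adjoint.
  refine ⟨(InnerProductSpace.continuousLinearMapOfBilin B).adjoint, fun ξ η => ?_⟩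
  rw [ContinuousLinearMap.adjoint_inner_right,
    InnerProductSpace.continuousLinearMapOfBilin_apply]
  exact hf ξ η

end WeakOperator

/-! ### Normal Schwarz maps and the Choi-Effros product -/

section SchwarzMap

variable {F : Type u} [NormedAddCommGroup F] [InnerProductSpace ℂ F] [CompleteSpace F]

/-- A unital contractive `*`-linear map on `B(F)` which satisfies the Schwarz inequality and is
continuous for the weak operator topology along bounded sequences. -/
structure IsNormalSchwarzMap (τ : (F →L[ℂ] F) → (F →L[ℂ] F)) : Prop where
  map_add : ∀ x y, τ (x + y) = τ x + τ y
  map_smul : ∀ (c : ℂ) x, τ (c • x) = c • τ x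
  map_one : τ 1 = 1
  map_star : ∀ x, τ (star x) = star (τ x)
  norm_le : ∀ x, ‖τ x‖ ≤ ‖x‖
  schwarz : ∀ x, star (τ x) * τ x ≤ τ (star x * x)
  normal : ∀ {l : Filter ℕ} {T : ℕ → F →L[ℂ] F} {S : F →L[ℂ] F} {C : ℝ}, (∀ n, ‖T n‖ ≤ C) →
    TendstoWOT T l S → TendstoWOT (fun n => τ (T n)) l (τ S)

namespace IsNormalSchwarzMap

variable {τ σ : (F →L[ℂ] F) → (F →L[ℂ] F)}

theorem map_sub (hτ : IsNormalSchwarzMap τ) (x y : F →L[ℂ] F) : τ (x - y) = τ x - τ y := by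
  rw [sub_eq_add_neg, ← neg_one_smul ℂ y, hτ.map_add, hτ.map_smul, neg_one_smul, sub_eq_add_neg]

theorem map_nonneg (hτ : IsNormalSchwarzMap τ) {x : F →L[ℂ] F} (hx : 0 ≤ x) : 0 ≤ τ x := by
  obtain ⟨b, rfl⟩ := CStarAlgebra.nonneg_iff_eq_star_mul_self.1 hx
  exact (star_mul_self_nonneg _).trans (hτ.schwarz b)

theorem mono (hτ : IsNormalSchwarzMap τ) {x y : F →L[ℂ] F} (h : x ≤ y) : τ x ≤ τ y := by
  rw [← sub_nonneg, ← hτ.map_sub]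
  exact hτ.map_nonneg (sub_nonneg.2 h)

theorem comp (hτ : IsNormalSchwarzMap τ) (hσ : IsNormalSchwarzMap σ) :
    IsNormalSchwarzMap (τ ∘ σ) where
  map_add x y := by simp only [Function.comp_apply, hσ.map_add, hτ.map_add]
  map_smul c x := by simp only [Function.comp_apply, hσ.map_smul, hτ.map_smul]
  map_one := by simp only [Function.comp_apply, hσ.map_one, hτ.map_one]
  map_star x := by simp only [Function.comp_apply, hσ.map_star, hτ.map_star]
  norm_le x := (hτ.norm_le _).trans (hσ.norm_le _)
  schwarz x := (hτ.schwarz _).trans (hτ.mono (hσ.schwarz x))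
  normal hT h := hτ.normal (fun n => (hσ.norm_le _).trans (hT n)) (hσ.normal hT h)

theorem iterate (hτ : IsNormalSchwarzMap τ) (n : ℕ) : IsNormalSchwarzMap τ^[n] := by
  induction n with
  | zero =>
    exact ⟨fun _ _ => rfl, fun _ _ => rfl, rfl, fun _ => rfl, fun _ => le_rfl, fun _ => le_rfl,
      fun _ h => h⟩
  | succ n ih =>
    rw [Function.iterate_succ']
    exact hτ.comp ih

theorem iterate_eigenvector (hτ : IsNormalSchwarzMap τ) {c : ℂ} {x : F →L[ℂ] F}
    (hx : τ x = c • x) (n : ℕ) : τ^[n] x = c ^ n • x := by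
  induction n with
  | zero => simp
  | succ n ih =>
    rw [Function.iterate_succ_apply', ih, hτ.map_smul, hx, smul_smul, pow_succ]

end IsNormalSchwarzMap

/-- The limit of `τ^n(x)` along an ultrafilter, in the weak operator topology. -/
noncomputable def ultraLimit (V : Ultrafilter ℕ) (τ : (F →L[ℂ] F) → (F →L[ℂ] F))
    (x : F →L[ℂ] F) : F →L[ℂ] F :=
  open Classical in
  if h : ∃ S, TendstoWOT (fun n => τ^[n] x) V S then h.choose else 0

section UltraLimit

variable {V : Ultrafilter ℕ} {τ : (F →L[ℂ] F) → (F →L[ℂ] F)}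

theorem ultraLimit_spec (V : Ultrafilter ℕ) (hτ : IsNormalSchwarzMap τ) (x : F →L[ℂ] F) :
    TendstoWOT (fun n => τ^[n] x) V (ultraLimit V τ x) := by
  have h := exists_tendstoWOT V (fun n => τ^[n] x) (fun n => (hτ.iterate n).norm_le x)
  unfold ultraLimit
  rw [dif_pos h]
  exact h.choose_spec

theorem ultraLimit_eq (hτ : IsNormalSchwarzMap τ) {x S : F →L[ℂ] F}
    (h : TendstoWOT (fun n => τ^[n] x) V S) : ultraLimit V τ x = S :=
  (ultraLimit_spec V hτ x).unique h

theorem ultraLimit_add (hτ : IsNormalSchwarzMap τ) (x y : F →L[ℂ] F) :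
    ultraLimit V τ (x + y) = ultraLimit V τ x + ultraLimit V τ y :=
  ultraLimit_eq hτ (by
    simpa only [(hτ.iterate _).map_add] using (ultraLimit_spec V hτ x).add (ultraLimit_spec V hτ y))

theorem ultraLimit_smul (hτ : IsNormalSchwarzMap τ) (c : ℂ) (x : F →L[ℂ] F) :
    ultraLimit V τ (c • x) = c • ultraLimit V τ x :=
  ultraLimit_eq hτ (by
    simpa only [(hτ.iterate _).map_smul] using
      (ultraLimit_spec V hτ x).smul (tendsto_const_nhds (x := c)))

theorem ultraLimit_star (hτ : IsNormalSchwarzMap τ) (x : F →L[ℂ] F) :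
    ultraLimit V τ (star x) = star (ultraLimit V τ x) :=
  ultraLimit_eq hτ (by simpa only [(hτ.iterate _).map_star] using (ultraLimit_spec V hτ x).star)

theorem norm_ultraLimit_le (hτ : IsNormalSchwarzMap τ) (x : F →L[ℂ] F) :
    ‖ultraLimit V τ x‖ ≤ ‖x‖ :=
  (ultraLimit_spec V hτ x).norm_le fun n => (hτ.iterate n).norm_le x

theorem ultraLimit_nonneg (hτ : IsNormalSchwarzMap τ) {x : F →L[ℂ] F} (hx : 0 ≤ x) :
    0 ≤ ultraLimit V τ x :=
  (ultraLimit_spec V hτ x).nonneg <| .of_forall fun n => (hτ.iterate n).map_nonneg hx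

/-- Multiplication is not jointly weakly continuous, so the limit is taken in an expression where
the limit y replaces one factor: τ^n(x^*x) - τ^n(x)^*y - y^*τ^n(x) + y^*y. It is nonnegative, being
the Schwarz defect of τ^n at x plus the square (τ^n(x) - y)^*(τ^n(x) - y). -/
theorem ultraLimit_schwarz (hτ : IsNormalSchwarzMap τ) (x : F →L[ℂ] F) :
    star (ultraLimit V τ x) * ultraLimit V τ x ≤ ultraLimit V τ (star x * x) := by
  set y := ultraLimit V τ x with hy
  have h := ultraLimit_spec V hτ x
  have h1 := (((ultraLimit_spec V hτ (star x * x)).sub (h.star.mul_const y)).sub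
    (h.const_mul (star y))).add (TendstoWOT.const (star y * y))
  rw [← hy, sub_add_cancel] at h1
  rw [← sub_nonneg]
  refine h1.nonneg (.of_forall fun n => ?_)
  have h2 := star_mul_self_nonneg (τ^[n] x - y)
  have h3 := sub_nonneg.2 ((hτ.iterate n).schwarz x)
  have h4 := add_nonneg h2 h3
  refine h4.trans_eq ?_
  simp only [star_sub, mul_sub, sub_mul]
  abel

/-- Normality moves τ^n inside the inner limit, and the iterated limit of τ^(n+k)(x) equals the
single one because V is idempotent. -/
theorem ultraLimit_ultraLimit
    (hV : ∀ p : ℕ → Prop, (∀ᶠ n in (V : Filter ℕ), p n) →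
      ∀ᶠ n in (V : Filter ℕ), ∀ᶠ k in (V : Filter ℕ), p (n + k))
    (hτ : IsNormalSchwarzMap τ) (x : F →L[ℂ] F) :
    ultraLimit V τ (ultraLimit V τ x) = ultraLimit V τ x := by
  have h := ultraLimit_spec V hτ x
  refine ContinuousLinearMap.ext fun ξ => ext_inner_left ℂ fun η => ?_
  refine eq_of_tendsto_idempotent hV (h ξ η) (fun n => ?_)
    (ultraLimit_spec V hτ (ultraLimit V τ x) ξ η)
  have := (hτ.iterate n).normal (fun k => (hτ.iterate k).norm_le x) h ξ η
  simpa only [Function.iterate_add_apply] using this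

theorem ultraLimit_eigenvector
    (hV : ∀ p : ℕ → Prop, (∀ᶠ n in (V : Filter ℕ), p n) →
      ∀ᶠ n in (V : Filter ℕ), ∀ᶠ k in (V : Filter ℕ), p (n + k))
    (hτ : IsNormalSchwarzMap τ) {c : ℂ} (hc : ‖c‖ = 1) {x : F →L[ℂ] F} (hx : τ x = c • x) :
    ultraLimit V τ x = x := by
  refine ultraLimit_eq hτ ?_
  simpa only [hτ.iterate_eigenvector hx, one_smul] using
    (TendstoWOT.const x).smul (tendsto_pow_idempotent hV hc)

/-- A real-affine function of s that is bounded below on ℂ has no linear part. -/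
theorem eq_zero_of_forall_add_smul_nonneg {q r : ℂ}
    (h : ∀ s : ℂ, 0 ≤ (r + s * q + starRingEnd ℂ (s * q)).re) : q = 0 := by
  by_contra hq
  have hq' : 0 < Complex.normSq q := Complex.normSq_pos.2 hq
  -- This s makes s q = -(Re r + 1), so the expression becomes -Re r - 2, whereas s = 0 gives Re r ≥
  -- 0.
  have h3 := h (-((r.re + 1) / Complex.normSq q : ℝ) * (starRingEnd ℂ q))
  have h4 : -(((r.re + 1) / Complex.normSq q : ℝ) : ℂ) * (starRingEnd ℂ q) * q =
      ((-(r.re + 1) : ℝ) : ℂ) := by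
    rw [mul_assoc, mul_comm (starRingEnd ℂ q), Complex.mul_conj, ← Complex.ofReal_neg,
      ← Complex.ofReal_mul]
    congr 1
    field_simp
  rw [h4] at h3
  have h5 := h 0
  simp at h3 h5
  linarith

/-- The Choi-Effros identity. -/
theorem ultraLimit_star_mul
    (hV : ∀ p : ℕ → Prop, (∀ᶠ n in (V : Filter ℕ), p n) →
      ∀ᶠ n in (V : Filter ℕ), ∀ᶠ k in (V : Filter ℕ), p (n + k))
    (hτ : IsNormalSchwarzMap τ) (a : F →L[ℂ] F) {b : F →L[ℂ] F} (hb : ultraLimit V τ b = b) :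
    ultraLimit V τ (star (ultraLimit V τ a) * b) = ultraLimit V τ (star a * b) := by
  let φ : (F →L[ℂ] F) →ₗ[ℂ] (F →L[ℂ] F) :=
    { toFun := ultraLimit V τ
      map_add' := ultraLimit_add hτ
      map_smul' := ultraLimit_smul hτ }
  have hs : ∀ x, φ (star x) = star (φ x) := ultraLimit_star hτ
  have hb' : φ b = b := hb
  have hφ : ∀ x, φ (φ x) = φ x := ultraLimit_ultraLimit hV hτ
  -- Apply φ to the Schwarz inequality and use φ² = φ.
  have hpos : ∀ x, 0 ≤ φ (star x * x) - φ (star (φ x) * φ x) := by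
    intro x
    have := ultraLimit_nonneg (V := V) hτ (sub_nonneg.2 (ultraLimit_schwarz (V := V) hτ x))
    change 0 ≤ φ (φ (star x * x) - star (φ x) * φ x) at this
    rwa [map_sub, hφ] at this
  set q := φ (star a * b) - φ (star (φ a) * b) with hq
  set r := φ (star a * a) - φ (star (φ a) * φ a) with hr
  have hqs : star q = φ (star b * a) - φ (star b * φ a) := by
    rw [hq, star_sub, ← hs, ← hs, star_mul, star_mul, star_star, star_star]
  -- This is `hpos` at a + s b. Since φ(b) = b, the terms in |s|² cancel, and what remains is affine
  -- in s, which forces q = 0.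
  have hexp : ∀ s : ℂ, 0 ≤ r + s • q + star (s • q) := by
    intro s
    refine (hpos (a + s • b)).trans_eq ?_
    rw [star_smul, hqs, hq, hr]
    simp only [star_add, star_smul, map_add, map_smul, hb', mul_add, add_mul, smul_mul_assoc,
      mul_smul_comm, smul_sub, smul_add]
    abel
  have hq0 : q = 0 := by
    have : (q : F →ₗ[ℂ] F) = 0 := by
      refine (inner_map_self_eq_zero _).1 fun ξ => ?_
      rw [← inner_conj_symm]
      refine (map_eq_zero _).2 (eq_zero_of_forall_add_smul_nonneg (r := inner ℂ ξ (r ξ))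
        fun s => ?_)
      have h1 := ((ContinuousLinearMap.nonneg_iff_isPositive _).1 (hexp s)).re_inner_nonneg_right ξ
      simp only [add_apply, inner_add_right, ContinuousLinearMap.star_eq_adjoint,
        ContinuousLinearMap.adjoint_inner_right] at h1
      rw [← inner_conj_symm ((s • q) ξ) ξ, smul_apply, inner_smul_right] at h1
      exact h1
    exact ContinuousLinearMap.coe_injective this
  exact (sub_eq_zero.1 hq0).symm

theorem ultraLimit_ultraLimit_mul
    (hV : ∀ p : ℕ → Prop, (∀ᶠ n in (V : Filter ℕ), p n) →
      ∀ᶠ n in (V : Filter ℕ), ∀ᶠ k in (V : Filter ℕ), p (n + k))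
    (hτ : IsNormalSchwarzMap τ) (a : F →L[ℂ] F) {b : F →L[ℂ] F} (hb : ultraLimit V τ b = b) :
    ultraLimit V τ (ultraLimit V τ a * b) = ultraLimit V τ (a * b) := by
  have := ultraLimit_star_mul hV hτ (star a) hb
  rwa [ultraLimit_star hτ, star_star, star_star] at this

theorem ultraLimit_mul_ultraLimit
    (hV : ∀ p : ℕ → Prop, (∀ᶠ n in (V : Filter ℕ), p n) →
      ∀ᶠ n in (V : Filter ℕ), ∀ᶠ k in (V : Filter ℕ), p (n + k))
    (hτ : IsNormalSchwarzMap τ) (a : F →L[ℂ] F) {b : F →L[ℂ] F} (hb : ultraLimit V τ b = b) :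
    ultraLimit V τ (b * ultraLimit V τ a) = ultraLimit V τ (b * a) := by
  have := ultraLimit_ultraLimit_mul hV hτ (star a) (b := star b) (by rw [ultraLimit_star hτ, hb])
  simpa only [← ultraLimit_star hτ, star_mul, star_star] using congrArg star this

end UltraLimit

end SchwarzMap

/-! ### The product on the peripheral Poisson boundary -/

section PeripheralBoundary

variable {A : Type u} [NormedRing A] [NormedAlgebra ℂ A] {τ : A → A}

theorem mem_peripheralPoissonBoundary {c : ℂ} {x : A} (hc : ‖c‖ = 1) (hx : τ x = c • x) :
    x ∈ peripheralPoissonBoundary τ :=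
  Submodule.le_topologicalClosure _ (Submodule.subset_span ⟨c, hc, hx⟩)

theorem isClosed_peripheralPoissonBoundary :
    IsClosed (peripheralPoissonBoundary τ : Set A) :=
  Submodule.isClosed_topologicalClosure _

theorem peripheralPoissonBoundary_le {S : Submodule ℂ A} (hS : IsClosed (S : Set A))
    (h : ∀ (c : ℂ) (x : A), ‖c‖ = 1 → τ x = c • x → x ∈ S) : peripheralPoissonBoundary τ ≤ S := by
  refine Submodule.topologicalClosure_minimal _ (Submodule.span_le.2 ?_) hS
  rintro x ⟨c, hc, hx⟩
  exact h c x hc hx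

theorem peripheralPoissonBoundary_ext {E : Type*} [AddCommMonoid E] [Module ℂ E]
    [TopologicalSpace E] [T2Space E]
    {f g : peripheralPoissonBoundary τ →L[ℂ] E}
    (h : ∀ (c : ℂ) (x : peripheralPoissonBoundary τ), ‖c‖ = 1 → τ (x : A) = c • (x : A) →
      f x = g x) : f = g := by
  have hcl : IsClosed ((LinearMap.eqLocus f.toLinearMap g.toLinearMap : Submodule ℂ (peripheralPoissonBoundary τ)) :
      Set (peripheralPoissonBoundary τ)) := isClosed_eq f.continuous g.continuous
  have hle : peripheralPoissonBoundary τ ≤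
      (LinearMap.eqLocus f.toLinearMap g.toLinearMap).map (peripheralPoissonBoundary τ).subtype := by
    refine peripheralPoissonBoundary_le ?_ fun c x hc hx =>
      ⟨⟨x, mem_peripheralPoissonBoundary hc hx⟩, h c _ hc hx, rfl⟩
    exact isClosed_peripheralPoissonBoundary.isClosedEmbedding_subtypeVal.isClosedMap _ hcl
  ext x
  obtain ⟨y, hy, hyx⟩ := hle x.2
  rwa [show y = x from Subtype.ext hyx] at hy

end PeripheralBoundary

section Product

variable {F : Type u} [NormedAddCommGroup F] [InnerProductSpace ℂ F] [CompleteSpace F]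
  {τ : (F →L[ℂ] F) → (F →L[ℂ] F)}

theorem IsModifiedChoiEffrosProduct.unique
    {m m' : peripheralPoissonBoundary τ →L[ℂ]
      peripheralPoissonBoundary τ →L[ℂ] peripheralPoissonBoundary τ}
    (h : IsModifiedChoiEffrosProduct τ m) (h' : IsModifiedChoiEffrosProduct τ m') : m = m' := by
  refine peripheralPoissonBoundary_ext (f := m) (g := m') fun c x hc hx => ?_
  refine peripheralPoissonBoundary_ext (f := m x) (g := m' x) fun d y hd hy => ?_
  refine Subtype.ext (ContinuousLinearMap.ext fun ξ => ?_)
  exact tendsto_nhds_unique (h c d x y hc hd hx hy ξ) (h' c d x y hc hd hx hy ξ)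

theorem IsUnitalCStarProduct.comm_of_eq_smul_one {A : Type u} [CStarAlgebra A] {S : Submodule ℂ A}
    {m : S →L[ℂ] S →L[ℂ] S} (h : IsUnitalCStarProduct S m) {x : S} {c : ℂ}
    (hx : (x : A) = c • (1 : A)) (y : S) : m x y = m y x := by
  obtain ⟨one, h1, hone⟩ := h.exists_one
  have hx' : x = c • one := Subtype.ext (by rw [hx, Submodule.coe_smul, h1])
  rw [hx', map_smul, map_smul, smul_apply, (hone y).1, (hone y).2]

theorem star_mem_peripheralPoissonBoundary (hτ : IsNormalSchwarzMap τ) {x : F →L[ℂ] F}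
    (hx : x ∈ peripheralPoissonBoundary τ) : star x ∈ peripheralPoissonBoundary τ := by
  have h : peripheralPoissonBoundary τ ≤ (peripheralPoissonBoundary τ).comap
      (starLinearEquiv ℂ (A := F →L[ℂ] F) : (F →L[ℂ] F) →ₗ⋆[ℂ] (F →L[ℂ] F)) := by
    refine peripheralPoissonBoundary_le
      (isClosed_peripheralPoissonBoundary.preimage continuous_star) fun c x hc hx => ?_
    exact mem_peripheralPoissonBoundary (c := star c) (by simpa using hc)
      (by simp [hτ.map_star, hx])
  exact h hx

theorem one_mem_peripheralPoissonBoundary (hτ : IsNormalSchwarzMap τ) :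
    (1 : F →L[ℂ] F) ∈ peripheralPoissonBoundary τ :=
  mem_peripheralPoissonBoundary (c := 1) (by simp) (by simp [hτ.map_one])

variable {V : Ultrafilter ℕ}

/-- The map `ultraLimit` as a continuous linear map. -/
noncomputable def ultraLimitL (V : Ultrafilter ℕ) (hτ : IsNormalSchwarzMap τ) :
    (F →L[ℂ] F) →L[ℂ] (F →L[ℂ] F) :=
  LinearMap.mkContinuous
    { toFun := ultraLimit V τ
      map_add' := ultraLimit_add hτ
      map_smul' := ultraLimit_smul hτ } 1
    (fun x => by simpa using norm_ultraLimit_le (V := V) hτ x)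

theorem ultraLimit_eq_self
    (hV : ∀ p : ℕ → Prop, (∀ᶠ n in (V : Filter ℕ), p n) →
      ∀ᶠ n in (V : Filter ℕ), ∀ᶠ k in (V : Filter ℕ), p (n + k))
    (hτ : IsNormalSchwarzMap τ) {x : F →L[ℂ] F} (hx : x ∈ peripheralPoissonBoundary τ) :
    ultraLimit V τ x = x := by
  have h : peripheralPoissonBoundary τ ≤
      LinearMap.eqLocus (ultraLimitL V hτ).toLinearMap
        (ContinuousLinearMap.id ℂ (F →L[ℂ] F)).toLinearMap :=
    peripheralPoissonBoundary_le
      (isClosed_eq (ultraLimitL V hτ).continuous (ContinuousLinearMap.id ℂ (F →L[ℂ] F)).continuous)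
      fun c x hc hx => ultraLimit_eigenvector hV hτ hc hx
  exact h hx

/-- Products of eigenvectors converge after normalization. -/
def HasPeripheralLimits (τ : (F →L[ℂ] F) → (F →L[ℂ] F)) : Prop :=
  ∀ (c d : ℂ) (x y : F →L[ℂ] F), ‖c‖ = 1 → ‖d‖ = 1 → τ x = c • x → τ y = d • y →
    ∃ z : F →L[ℂ] F, ∀ ξ : F, Filter.Tendsto
      (fun n : ℕ => ((c * d) ^ n)⁻¹ • (τ^[n] (x * y)) ξ) Filter.atTop (nhds (z ξ))

/-- Along V the normalizing factors tend to 1 and drop out of the limit. Shifting n by one and using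
normality shows that the limit is again a peripheral eigenvector, which keeps the product inside the
boundary. -/
theorem ultraLimit_mul_eigenvectors (hVtop : (V : Filter ℕ) ≤ Filter.atTop)
    (hV : ∀ p : ℕ → Prop, (∀ᶠ n in (V : Filter ℕ), p n) →
      ∀ᶠ n in (V : Filter ℕ), ∀ᶠ k in (V : Filter ℕ), p (n + k))
    (hτ : IsNormalSchwarzMap τ) {c d : ℂ} (hc : ‖c‖ = 1) (hd : ‖d‖ = 1) {x y z : F →L[ℂ] F}
    (hz : ∀ ξ : F, Filter.Tendsto
      (fun n : ℕ => ((c * d) ^ n)⁻¹ • (τ^[n] (x * y)) ξ) Filter.atTop (nhds (z ξ))) :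
    ultraLimit V τ (x * y) = z ∧ τ z = (c * d) • z := by
  have hcd : ‖c * d‖ = 1 := by rw [norm_mul, hc, hd, one_mul]
  have hcd0 : c * d ≠ 0 := norm_ne_zero_iff.1 (by rw [hcd]; exact one_ne_zero)
  set T : ℕ → F →L[ℂ] F := fun n => ((c * d) ^ n)⁻¹ • τ^[n] (x * y) with hT
  have hW : TendstoWOT T Filter.atTop z := TendstoWOT.of_strong hz
  have hTn : ∀ n, ‖T n‖ ≤ ‖x * y‖ := by
    intro n
    rw [hT]
    simp only [norm_smul, norm_inv, norm_pow, hcd, one_pow, inv_one, one_mul]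
    exact (hτ.iterate n).norm_le _
  constructor
  · refine ultraLimit_eq hτ ?_
    have h1 : TendstoWOT T V z := fun ξ η => (hW ξ η).mono_left hVtop
    have h2 := h1.smul (tendsto_pow_idempotent hV hcd)
    simpa only [hT, smul_inv_smul₀ (pow_ne_zero _ hcd0), one_smul] using h2
  · refine (hτ.normal hTn hW).unique ?_
    have h1 : TendstoWOT (fun n => T (n + 1)) Filter.atTop z :=
      fun ξ η => (hW ξ η).comp (Filter.tendsto_add_atTop_nat 1)
    have h2 := h1.smul (tendsto_const_nhds (x := c * d))
    have h3 : ∀ n, τ (T n) = (c * d) • T (n + 1) := by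
      intro n
      simp only [hT, hτ.map_smul, Function.iterate_succ_apply', smul_smul]
      rw [pow_succ', mul_inv, mul_inv_cancel_left₀ hcd0]
    simpa only [h3] using h2

theorem ultraLimit_mul_mem (hVtop : (V : Filter ℕ) ≤ Filter.atTop)
    (hV : ∀ p : ℕ → Prop, (∀ᶠ n in (V : Filter ℕ), p n) →
      ∀ᶠ n in (V : Filter ℕ), ∀ᶠ k in (V : Filter ℕ), p (n + k))
    (hτ : IsNormalSchwarzMap τ) (hlim : HasPeripheralLimits τ) {x y : F →L[ℂ] F}
    (hx : x ∈ peripheralPoissonBoundary τ) (hy : y ∈ peripheralPoissonBoundary τ) :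
    ultraLimit V τ (x * y) ∈ peripheralPoissonBoundary τ := by
  have key : ∀ (c : ℂ) (x : F →L[ℂ] F), ‖c‖ = 1 → τ x = c • x →
      ∀ y ∈ peripheralPoissonBoundary τ,
        ultraLimit V τ (x * y) ∈ peripheralPoissonBoundary τ := by
    intro c x hc hx
    have h : peripheralPoissonBoundary τ ≤ (peripheralPoissonBoundary τ).comap
        (((ultraLimitL V hτ) ∘L (ContinuousLinearMap.mul ℂ (F →L[ℂ] F) x)).toLinearMap) := by
      refine peripheralPoissonBoundary_le
        (isClosed_peripheralPoissonBoundary.preimage (ContinuousLinearMap.continuous _))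
        fun d y hd hy => ?_
      obtain ⟨z, hz⟩ := hlim c d x y hc hd hx hy
      obtain ⟨h1, h2⟩ := ultraLimit_mul_eigenvectors hVtop hV hτ hc hd hz
      change ultraLimit V τ (x * y) ∈ peripheralPoissonBoundary τ
      rw [h1]
      exact mem_peripheralPoissonBoundary (by rw [norm_mul, hc, hd, one_mul]) h2
    exact fun y hy => h hy
  have h : peripheralPoissonBoundary τ ≤ (peripheralPoissonBoundary τ).comap
      (((ultraLimitL V hτ) ∘L
        ((ContinuousLinearMap.mul ℂ (F →L[ℂ] F)).flip y)).toLinearMap) := by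
    refine peripheralPoissonBoundary_le
      (isClosed_peripheralPoissonBoundary.preimage (ContinuousLinearMap.continuous _))
      fun c x hc hx => key c x hc hx y hy
  exact h hx

/-- Both bracketings of a triple product equal Φ(xyz) by the Choi-Effros identity. The nontrivial
half of the C*-identity is the Schwarz inequality x^*x ≤ Φ(x^*x), valid since Φ(x) = x. -/
theorem exists_modifiedChoiEffrosProduct (hVtop : (V : Filter ℕ) ≤ Filter.atTop)
    (hV : ∀ p : ℕ → Prop, (∀ᶠ n in (V : Filter ℕ), p n) →
      ∀ᶠ n in (V : Filter ℕ), ∀ᶠ k in (V : Filter ℕ), p (n + k))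
    (hτ : IsNormalSchwarzMap τ) (hlim : HasPeripheralLimits τ) :
    ∃ m : peripheralPoissonBoundary τ →L[ℂ]
        peripheralPoissonBoundary τ →L[ℂ] peripheralPoissonBoundary τ,
      (∀ x y, (m x y : F →L[ℂ] F) = ultraLimit V τ (x * y)) ∧
      IsModifiedChoiEffrosProduct τ m ∧
      IsUnitalCStarProduct (peripheralPoissonBoundary τ) m := by
  have hmem := fun x y : peripheralPoissonBoundary τ =>
    ultraLimit_mul_mem hVtop hV hτ hlim x.2 y.2
  have hnorm : ∀ x y : F →L[ℂ] F, ‖ultraLimit V τ (x * y)‖ ≤ ‖x‖ * ‖y‖ :=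
    fun x y => (norm_ultraLimit_le hτ _).trans (norm_mul_le _ _)
  let m : peripheralPoissonBoundary τ →L[ℂ]
      peripheralPoissonBoundary τ →L[ℂ] peripheralPoissonBoundary τ :=
    LinearMap.mkContinuous₂
      (LinearMap.mk₂ ℂ (fun x y => (⟨_, hmem x y⟩ : peripheralPoissonBoundary τ))
        (fun x x' y => Subtype.ext (by
          simp only [Submodule.coe_add, add_mul, ultraLimit_add hτ]))
        (fun c x y => Subtype.ext (by
          simp only [Submodule.coe_smul, smul_mul_assoc, ultraLimit_smul hτ]))
        (fun x y y' => Subtype.ext (by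
          simp only [Submodule.coe_add, mul_add, ultraLimit_add hτ]))
        (fun c x y => Subtype.ext (by
          simp only [Submodule.coe_smul, mul_smul_comm, ultraLimit_smul hτ]))) 1
      (fun x y => by
        rw [one_mul]
        exact hnorm x y)
  have hm : ∀ x y, (m x y : F →L[ℂ] F) = ultraLimit V τ (x * y) := fun _ _ => rfl
  have hself : ∀ x : peripheralPoissonBoundary τ, ultraLimit V τ (x : F →L[ℂ] F) = x :=
    fun x => ultraLimit_eq_self hV hτ x.2
  refine ⟨m, hm, ?_, ?_⟩
  · intro c d x y hc hd hx hy
    obtain ⟨z, hz⟩ := hlim c d x y hc hd hx hy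
    rw [hm, (ultraLimit_mul_eigenvectors hVtop hV hτ hc hd hz).1]
    exact hz
  · refine ⟨isClosed_peripheralPoissonBoundary, ?_, ?_, ?_,
      fun x hx => star_mem_peripheralPoissonBoundary hτ hx, ?_, ?_⟩
    · intro x y z
      refine Subtype.ext ?_
      rw [hm, hm, hm, hm, ultraLimit_ultraLimit_mul hV hτ _ (hself z),
        ultraLimit_mul_ultraLimit hV hτ _ (hself x), mul_assoc]
    · refine ⟨⟨1, one_mem_peripheralPoissonBoundary hτ⟩, rfl, fun x => ⟨?_, ?_⟩⟩
      · refine Subtype.ext ?_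
        rw [hm, one_mul, hself]
      · refine Subtype.ext ?_
        rw [hm, mul_one, hself]
    · exact fun x y => hnorm x y
    · intro x y
      rw [hm, hm, ← ultraLimit_star hτ, star_mul]
    · intro x
      refine le_antisymm ?_ ?_
      · refine (hnorm _ _).trans ?_
        rw [norm_star, pow_two]
        rfl
      · have h1 := ultraLimit_schwarz (V := V) hτ (x : F →L[ℂ] F)
        rw [hself] at h1
        have h2 := CStarAlgebra.norm_le_norm_of_nonneg_of_le (star_mul_self_nonneg _) h1
        rw [CStarRing.norm_star_mul_self, ← pow_two] at h2
        exact h2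

end Product

/-! ### Minimal dilations -/

namespace VonNeumannAlgebra

variable {K : Type w} [NormedAddCommGroup K] [InnerProductSpace ℂ K] [CompleteSpace K]
  (B : VonNeumannAlgebra K)

theorem mem_iff_forall_commute {z : K →L[ℂ] K} :
    z ∈ B.toStarSubalgebra ↔ ∀ g ∈ B.commutant, g * z = z * g := by
  have h := B.commutant.mem_commutant_iff (z := z)
  rw [commutant_commutant] at h
  exact h

theorem mem_of_tendstoWOT {ι : Type*} {l : Filter ι} [l.NeBot] {T : ι → K →L[ℂ] K}
    {z : K →L[ℂ] K} (hT : ∀ n, T n ∈ B.toStarSubalgebra) (h : TendstoWOT T l z) :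
    z ∈ B.toStarSubalgebra := by
  rw [mem_iff_forall_commute]
  intro g hg
  refine (h.const_mul g).unique ?_
  have h1 := h.mul_const g
  have h2 : ∀ n, T n * g = g * T n := fun n => ((mem_iff_forall_commute B).1 (hT n) g hg).symm
  simpa only [h2] using h1

theorem isClosed_toStarSubalgebra : IsClosed (B.toStarSubalgebra : Set (K →L[ℂ] K)) := by
  have : (B.toStarSubalgebra : Set (K →L[ℂ] K)) =
      ⋂ g ∈ B.commutant, {z | g * z = z * g} := by
    ext z
    simp only [Set.mem_iInter, Set.mem_ofPred_eq]
    exact mem_iff_forall_commute B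
  rw [this]
  exact isClosed_biInter fun g _ => isClosed_eq (by fun_prop) (by fun_prop)

instance : CompleteSpace B.toStarSubalgebra :=
  (isClosed_toStarSubalgebra B).completeSpace_coe

theorem norm_starAlgHom_apply_le (θ : B.toStarSubalgebra →⋆ₐ[ℂ] B.toStarSubalgebra)
    (z : B.toStarSubalgebra) : ‖θ z‖ ≤ ‖z‖ := by
  have : IsClosed (B.toStarSubalgebra : Set (K →L[ℂ] K)) := isClosed_toStarSubalgebra B
  exact NonUnitalStarAlgHom.norm_apply_le θ z

end VonNeumannAlgebra

namespace MinimalDilation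

variable {F : Type u} [NormedAddCommGroup F] [InnerProductSpace ℂ F] [CompleteSpace F]
  {τ : (F →L[ℂ] F) → (F →L[ℂ] F)}
  {K : Type w} [NormedAddCommGroup K] [InnerProductSpace ℂ K] [CompleteSpace K]
  (D : MinimalDilation τ K)

theorem adjoint_V_apply_V (ξ : F) :
    D.V.toContinuousLinearMap.adjoint (D.V.toContinuousLinearMap ξ) = ξ :=
  ext_inner_left ℂ fun η => by
    rw [ContinuousLinearMap.adjoint_inner_right]
    exact D.V.inner_map_map η ξ

/-- The operator `x` on `F`, as an element of the corner `p B(K) p`. -/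
noncomputable def corner (x : F →L[ℂ] F) : D.B.toStarSubalgebra :=
  ⟨_, D.corner_mem x⟩

theorem coe_corner (x : F →L[ℂ] F) : (D.corner x : K →L[ℂ] K) =
    D.V.toContinuousLinearMap ∘L x ∘L D.V.toContinuousLinearMap.adjoint := rfl

theorem corner_apply (x : F →L[ℂ] F) (ξ : K) : (D.corner x : K →L[ℂ] K) ξ =
    D.V.toContinuousLinearMap (x (D.V.toContinuousLinearMap.adjoint ξ)) := rfl

theorem compression_apply (z : D.B.toStarSubalgebra) (ξ : F) : D.compression z ξ =
    D.V.toContinuousLinearMap.adjoint ((z : K →L[ℂ] K) (D.V.toContinuousLinearMap ξ)) := rfl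

theorem compression_iterate_corner (n : ℕ) (x : F →L[ℂ] F) :
    D.compression (D.θ^[n] (D.corner x)) = τ^[n] x := (D.dilates n x).symm

theorem compression_corner (x : F →L[ℂ] F) : D.compression (D.corner x) = x :=
  D.compression_iterate_corner 0 x

theorem corner_mul (x y : F →L[ℂ] F) : D.corner (x * y) = D.corner x * D.corner y := by
  refine Subtype.ext (ContinuousLinearMap.ext fun ξ => ?_)
  change _ = (D.corner x : K →L[ℂ] K) ((D.corner y : K →L[ℂ] K) ξ)
  simp only [corner_apply, adjoint_V_apply_V]
  rfl

theorem corner_smul (c : ℂ) (x : F →L[ℂ] F) : D.corner (c • x) = c • D.corner x := by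
  refine Subtype.ext (ContinuousLinearMap.ext fun ξ => ?_)
  change _ = c • (D.corner x : K →L[ℂ] K) ξ
  simp only [corner_apply, smul_apply, map_smul]

theorem star_corner (x : F →L[ℂ] F) : star (D.corner x) = D.corner (star x) := by
  refine Subtype.ext ?_
  change star (D.corner x : K →L[ℂ] K) = _
  simp only [coe_corner, ContinuousLinearMap.star_eq_adjoint, ContinuousLinearMap.adjoint_comp,
    ContinuousLinearMap.adjoint_adjoint]
  rfl

theorem corner_compression (z : D.B.toStarSubalgebra) :
    D.corner (D.compression z) = D.corner 1 * z * D.corner 1 := by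
  refine Subtype.ext (ContinuousLinearMap.ext fun ξ => ?_)
  change _ = (D.corner 1 : K →L[ℂ] K) ((z : K →L[ℂ] K) ((D.corner 1 : K →L[ℂ] K) ξ))
  simp only [corner_apply, compression_apply, one_apply_eq_self]

theorem compression_corner_one_mul (z : D.B.toStarSubalgebra) :
    D.compression (D.corner 1 * z * D.corner 1) = D.compression z := by
  refine ContinuousLinearMap.ext fun ξ => ?_
  rw [compression_apply, compression_apply]
  change D.V.toContinuousLinearMap.adjoint
    ((D.corner 1 : K →L[ℂ] K) ((z : K →L[ℂ] K) ((D.corner 1 : K →L[ℂ] K) _))) = _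
  simp only [corner_apply, adjoint_V_apply_V, one_apply_eq_self]

theorem norm_V_le : ‖D.V.toContinuousLinearMap‖ ≤ 1 := D.V.norm_toContinuousLinearMap_le

theorem norm_compression_le (z : D.B.toStarSubalgebra) : ‖D.compression z‖ ≤ ‖z‖ := by
  refine (D.compression z).opNorm_le_bound (norm_nonneg _) fun ξ => ?_
  rw [compression_apply]
  have h1 : ‖D.V.toContinuousLinearMap.adjoint‖ ≤ 1 := by
    rw [LinearIsometryEquiv.norm_map]
    exact D.norm_V_le
  refine (ContinuousLinearMap.le_of_opNorm_le _ h1 _).trans ?_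
  rw [one_mul]
  exact ((z : K →L[ℂ] K).le_opNorm _).trans (by
    rw [D.V.coe_toContinuousLinearMap, D.V.norm_map]
    rfl)

theorem norm_corner_le (x : F →L[ℂ] F) : ‖D.corner x‖ ≤ ‖x‖ := by
  change ‖(D.corner x : K →L[ℂ] K)‖ ≤ ‖x‖
  refine ContinuousLinearMap.opNorm_le_bound _ (norm_nonneg _) fun ξ => ?_
  have h1 : ‖D.V.toContinuousLinearMap.adjoint‖ ≤ 1 := by
    rw [LinearIsometryEquiv.norm_map]
    exact D.norm_V_le
  rw [corner_apply, D.V.coe_toContinuousLinearMap, D.V.norm_map]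
  refine (x.le_opNorm _).trans ?_
  gcongr
  simpa using ContinuousLinearMap.le_of_opNorm_le _ h1 ξ

/-- The compression as a continuous linear map. -/
noncomputable def compressionL : D.B.toStarSubalgebra →L[ℂ] (F →L[ℂ] F) :=
  LinearMap.mkContinuous
    { toFun := D.compression
      map_add' := fun z z' => by
        refine ContinuousLinearMap.ext fun ξ => ?_
        rw [add_apply, compression_apply, compression_apply, compression_apply, ← map_add]
        rfl
      map_smul' := fun c z => by
        refine ContinuousLinearMap.ext fun ξ => ?_
        rw [smul_apply, compression_apply, compression_apply, RingHom.id_apply, ← map_smul]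
        rfl } 1
    (fun z => by
      rw [one_mul]
      exact D.norm_compression_le z)

theorem compressionL_apply (z : D.B.toStarSubalgebra) : D.compressionL z = D.compression z := rfl

theorem iterate_mul (n : ℕ) (z z' : D.B.toStarSubalgebra) :
    D.θ^[n] (z * z') = D.θ^[n] z * D.θ^[n] z' := iterate_map_mul D.θ n z z'

theorem iterate_smul (n : ℕ) (c : ℂ) (z : D.B.toStarSubalgebra) :
    D.θ^[n] (c • z) = c • D.θ^[n] z := by
  induction n with
  | zero => rfl
  | succ n ih => rw [Function.iterate_succ_apply', Function.iterate_succ_apply', ih, map_smul]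

theorem iterate_star (n : ℕ) (z : D.B.toStarSubalgebra) :
    D.θ^[n] (star z) = star (D.θ^[n] z) := by
  induction n with
  | zero => rfl
  | succ n ih => rw [Function.iterate_succ_apply', Function.iterate_succ_apply', ih, map_star]

theorem iterate_eigenvector {c : ℂ} {z : D.B.toStarSubalgebra} (hz : D.θ z = c • z) (n : ℕ) :
    D.θ^[n] z = c ^ n • z := by
  induction n with
  | zero => simp
  | succ n ih => rw [Function.iterate_succ_apply', ih, map_smul, hz, smul_smul, pow_succ]

theorem norm_iterate_le (n : ℕ) (z : D.B.toStarSubalgebra) : ‖D.θ^[n] z‖ ≤ ‖z‖ := by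
  induction n with
  | zero => rfl
  | succ n ih =>
    rw [Function.iterate_succ_apply']
    exact (D.B.norm_starAlgHom_apply_le D.θ _).trans ih

/-- The projections `θ^n(p)`. -/
noncomputable def proj (n : ℕ) : D.B.toStarSubalgebra := D.θ^[n] (D.corner 1)

theorem star_proj (n : ℕ) : star (D.proj n) = D.proj n := by
  rw [proj, ← iterate_star, star_corner, star_one]

theorem proj_mul_iterate_corner (n : ℕ) (x : F →L[ℂ] F) :
    D.proj n * D.θ^[n] (D.corner x) = D.θ^[n] (D.corner x) := by
  rw [proj, ← iterate_mul, ← corner_mul, one_mul]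

theorem theta_proj (n : ℕ) : D.θ (D.proj n) = D.proj (n + 1) :=
  (Function.iterate_succ_apply' _ _ _).symm

theorem proj_mul_iterate_mul_proj (n : ℕ) (z : D.B.toStarSubalgebra) :
    D.proj n * D.θ^[n] z * D.proj n = D.θ^[n] (D.corner (D.compression z)) := by
  rw [corner_compression, iterate_mul, iterate_mul]
  rfl

variable (hτ : IsNormalSchwarzMap τ)
include hτ

/-- Since τ(1) = 1, compressing θ(p) by p gives p θ(p) p = p. Hence (θ(p)p - p)^*(θ(p)p - p) = 0,
that is, p ≤ θ(p). -/
theorem proj_one_mul_proj_zero : D.proj 1 * D.proj 0 = D.proj 0 := by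
  have h0 : D.proj 0 * D.proj 0 = D.proj 0 := D.proj_mul_iterate_corner 0 1
  have h1 : D.proj 1 * D.proj 1 = D.proj 1 := D.proj_mul_iterate_corner 1 1
  have h2 : D.proj 0 * D.proj 1 * D.proj 0 = D.proj 0 := by
    have h3 : D.compression (D.proj 1) = 1 := by
      rw [proj, compression_iterate_corner, (hτ.iterate 1).map_one]
    have := D.corner_compression (D.proj 1)
    rw [h3] at this
    exact this.symm
  rw [← sub_eq_zero, ← CStarRing.star_mul_self_eq_zero_iff]
  simp only [star_sub, star_mul, star_proj, mul_sub, sub_mul]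
  have h4 : D.proj 0 * D.proj 1 * (D.proj 1 * D.proj 0) = D.proj 0 := by
    rw [← mul_assoc, mul_assoc (D.proj 0), h1, h2]
  rw [h4, h0, h2, ← mul_assoc, h2]
  simp

theorem proj_mul_proj {n k : ℕ} (h : n ≤ k) : D.proj k * D.proj n = D.proj n := by
  induction k, h using Nat.le_induction with
  | base => exact D.proj_mul_iterate_corner n 1
  | succ k hk ih =>
    have h1 : D.proj (k + 1) * D.proj k = D.proj k := by
      have := congrArg D.θ^[k] (D.proj_one_mul_proj_zero hτ)
      rw [iterate_mul] at this
      simpa only [proj, ← Function.iterate_add_apply, add_zero] using this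
    rw [← ih, ← mul_assoc, h1]

theorem proj_mul_proj' {n k : ℕ} (h : n ≤ k) : D.proj n * D.proj k = D.proj n := by
  have := congrArg star (D.proj_mul_proj hτ h)
  rwa [star_mul, star_proj, star_proj] at this

theorem norm_proj_le (n : ℕ) : ‖D.proj n‖ ≤ 1 := by
  have h : star (D.proj n) * D.proj n = D.proj n := by
    rw [star_proj, D.proj_mul_proj hτ le_rfl]
  have h1 := CStarRing.norm_star_mul_self (x := D.proj n)
  rw [h] at h1
  rcases (norm_nonneg (D.proj n)).eq_or_lt with h0 | h0
  · rw [← h0]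
    exact zero_le_one
  · exact (mul_right_cancel₀ h0.ne' ((one_mul _).trans h1)).symm.le

theorem proj_mul_iterate_corner_of_le {n k : ℕ} (h : n ≤ k) (x : F →L[ℂ] F) :
    D.proj k * D.θ^[n] (D.corner x) = D.θ^[n] (D.corner x) := by
  rw [← proj_mul_iterate_corner, ← mul_assoc, D.proj_mul_proj hτ h]

theorem proj_apply_V (n : ℕ) (ξ : F) : (D.proj n : K →L[ℂ] K) (D.V.toContinuousLinearMap ξ) =
    D.V.toContinuousLinearMap ξ := by
  have h1 : (D.corner 1 : K →L[ℂ] K) (D.V.toContinuousLinearMap ξ) =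
      D.V.toContinuousLinearMap ξ := by
    rw [corner_apply, adjoint_V_apply_V]
    rfl
  have h2 := congrArg (fun z : D.B.toStarSubalgebra =>
    (z : K →L[ℂ] K) (D.V.toContinuousLinearMap ξ)) (D.proj_mul_proj hτ (Nat.zero_le n))
  change (D.proj n : K →L[ℂ] K) ((D.corner 1 : K →L[ℂ] K) _) = (D.corner 1 : K →L[ℂ] K) _ at h2
  rwa [h1] at h2

/-- This is where minimality enters. If the leftmost factor of a generating vector is θ^k(x), then
p_n fixes the vector for n ≥ k; vectors of F are fixed by all p_n. Density and the bound ‖p_n‖ ≤ 1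
give the rest. -/
theorem tendsto_proj (ξ : K) :
    Filter.Tendsto (fun n => (D.proj n : K →L[ℂ] K) ξ) Filter.atTop (nhds ξ) := by
  have hspan : ∀ ζ ∈ Submodule.span ℂ {ζ : K | ∃ (s : List (ℕ × (F →L[ℂ] F))) (ξ : F),
      ζ = (s.map fun q => (D.θ^[q.1] ⟨_, D.corner_mem q.2⟩ : K →L[ℂ] K)).prod (D.V ξ)},
      ∃ N, ∀ n ≥ N, (D.proj n : K →L[ℂ] K) ζ = ζ := by
    intro ζ hζ
    induction hζ using Submodule.span_induction with
    | mem ζ hζ =>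
      obtain ⟨s, η, rfl⟩ := hζ
      rcases s with _ | ⟨q, s⟩
      · exact ⟨0, fun n _ => D.proj_apply_V hτ n η⟩
      · refine ⟨q.1, fun n hn => ?_⟩
        have h := congrArg (fun z : D.B.toStarSubalgebra => (z : K →L[ℂ] K)
          ((s.map fun q => (D.θ^[q.1] ⟨_, D.corner_mem q.2⟩ : K →L[ℂ] K)).prod (D.V η)))
          (D.proj_mul_iterate_corner_of_le hτ hn q.2)
        rw [List.map_cons, List.prod_cons]
        exact h
    | zero => exact ⟨0, fun n _ => map_zero _⟩
    | add ζ ζ' _ _ h h' =>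
      obtain ⟨N, hN⟩ := h
      obtain ⟨N', hN'⟩ := h'
      refine ⟨max N N', fun n hn => ?_⟩
      rw [map_add, hN n (le_of_max_le_left hn), hN' n (le_of_max_le_right hn)]
    | smul c ζ _ h =>
      obtain ⟨N, hN⟩ := h
      exact ⟨N, fun n hn => by rw [map_smul, hN n hn]⟩
  have hmem : ξ ∈ (Submodule.span ℂ {ζ : K | ∃ (s : List (ℕ × (F →L[ℂ] F))) (ξ : F),
      ζ = (s.map fun q => (D.θ^[q.1] ⟨_, D.corner_mem q.2⟩ : K →L[ℂ] K)).prod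
        (D.V ξ)}).topologicalClosure := by
    rw [D.cyclic]
    exact Submodule.mem_top
  rw [Metric.tendsto_atTop]
  intro ε hε
  obtain ⟨ζ, hζ, hd⟩ := Metric.mem_closure_iff.1 hmem (ε / 2) (by positivity)
  obtain ⟨N, hN⟩ := hspan ζ hζ
  refine ⟨N, fun n hn => ?_⟩
  rw [dist_eq_norm] at hd ⊢
  have h1 : (D.proj n : K →L[ℂ] K) ξ - ξ = (D.proj n : K →L[ℂ] K) (ξ - ζ) - (ξ - ζ) := by
    rw [map_sub, hN n hn]
    abel
  have h2 : ‖(D.proj n : K →L[ℂ] K) (ξ - ζ)‖ ≤ 1 * ‖ξ - ζ‖ :=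
    ContinuousLinearMap.le_of_opNorm_le _ (D.norm_proj_le hτ n) _
  rw [h1]
  refine (norm_sub_le _ _).trans_lt ?_
  linarith

theorem tendstoWOT_proj_mul_mul_proj {l : Filter ℕ} (hl : l ≤ Filter.atTop)
    {T : ℕ → K →L[ℂ] K} {S : K →L[ℂ] K} (hT : Filter.Tendsto T l (nhds S)) :
    TendstoWOT (fun n => (D.proj n : K →L[ℂ] K) * T n * (D.proj n : K →L[ℂ] K)) l S := by
  intro ξ η
  have h1 : ∀ n, inner ℂ η (((D.proj n : K →L[ℂ] K) * T n * (D.proj n : K →L[ℂ] K)) ξ) =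
      inner ℂ ((D.proj n : K →L[ℂ] K) η) (T n ((D.proj n : K →L[ℂ] K) ξ)) := by
    intro n
    have hs : (D.proj n : K →L[ℂ] K).adjoint = D.proj n := congrArg Subtype.val (D.star_proj n)
    conv_rhs => rw [← hs, ContinuousLinearMap.adjoint_inner_left, hs]
    rfl
  simp only [h1]
  exact ((D.tendsto_proj hτ η).mono_left hl).inner
    ((isBoundedBilinearMap_apply.continuous.tendsto (S, ξ)).comp
      (hT.prodMk_nhds ((D.tendsto_proj hτ ξ).mono_left hl)))

/-- Extends the dilation property from the corner to all of B: as p ≤ p_n, the projections p_n can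
be inserted around θ^n(z), which turns it into θ^n(pzp). -/
theorem compression_iterate (n : ℕ) (z : D.B.toStarSubalgebra) :
    D.compression (D.θ^[n] z) = τ^[n] (D.compression z) := by
  have h1 : D.corner 1 * D.proj n = D.corner 1 := D.proj_mul_proj' hτ (Nat.zero_le n)
  have h2 : D.proj n * D.corner 1 = D.corner 1 := D.proj_mul_proj hτ (Nat.zero_le n)
  calc D.compression (D.θ^[n] z)
      = D.compression (D.corner 1 * D.θ^[n] z * D.corner 1) :=
        (D.compression_corner_one_mul _).symm
    _ = D.compression (D.corner 1 * (D.proj n * D.θ^[n] z * D.proj n) * D.corner 1) := by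
        have h3 : D.corner 1 * (D.proj n * D.θ^[n] z * D.proj n) * D.corner 1 =
            D.corner 1 * D.proj n * D.θ^[n] z * (D.proj n * D.corner 1) := by
          simp only [mul_assoc]
        rw [h3, h1, h2]
    _ = τ^[n] (D.compression z) := by
        rw [compression_corner_one_mul, proj_mul_iterate_mul_proj, compression_iterate_corner]

theorem compression_eigenvector {c : ℂ} {z : D.B.toStarSubalgebra} (hz : D.θ z = c • z) :
    τ (D.compression z) = c • D.compression z := by
  have h := D.compression_iterate hτ 1 z
  rw [Function.iterate_one, Function.iterate_one, hz] at h
  rw [← h]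
  exact map_smul D.compressionL c z

end MinimalDilation

namespace MinimalDilation

variable {F : Type u} [NormedAddCommGroup F] [InnerProductSpace ℂ F] [CompleteSpace F]
  {τ : (F →L[ℂ] F) → (F →L[ℂ] F)}
  {K : Type w} [NormedAddCommGroup K] [InnerProductSpace ℂ K] [CompleteSpace K]
  (D : MinimalDilation τ K) (hτ : IsNormalSchwarzMap τ)
include hτ

/-- Compressing `θ^n(x)` to the range of `θ^k(p)`, for an eigenvector `x` of `τ`. -/
theorem proj_mul_iterate_corner_mul_proj {c : ℂ} {x : F →L[ℂ] F} (hx : τ x = c • x) (k n : ℕ) :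
    D.proj k * D.θ^[k + n] (D.corner x) * D.proj k = c ^ n • D.θ^[k] (D.corner x) := by
  rw [Function.iterate_add_apply, proj_mul_iterate_mul_proj, compression_iterate_corner,
    hτ.iterate_eigenvector hx, corner_smul, iterate_smul]

/-- Eigenvectors of `τ` lift to eigenvectors of the dilation. -/
theorem exists_lift_eigenvector {V : Ultrafilter ℕ} (hVtop : (V : Filter ℕ) ≤ Filter.atTop)
    {c : ℂ} (hc : ‖c‖ = 1) {x : F →L[ℂ] F} (hx : τ x = c • x) :
    ∃ z : D.B.toStarSubalgebra, D.θ z = c • z ∧ D.compression z = x := by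
  have hc0 : c ≠ 0 := norm_ne_zero_iff.1 (by rw [hc]; exact one_ne_zero)
  set a : ℕ → D.B.toStarSubalgebra := fun n => (c ^ n)⁻¹ • D.θ^[n] (D.corner x) with ha
  have han : ∀ n, ‖(a n : K →L[ℂ] K)‖ ≤ ‖x‖ := by
    intro n
    change ‖a n‖ ≤ ‖x‖
    rw [ha]
    simp only [norm_smul, norm_inv, norm_pow, hc, one_pow, inv_one, one_mul]
    exact (D.norm_iterate_le n _).trans (D.norm_corner_le x)
  obtain ⟨S, hS⟩ := exists_tendstoWOT V (fun n => (a n : K →L[ℂ] K)) han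
  let z : D.B.toStarSubalgebra := ⟨S, D.B.mem_of_tendstoWOT (fun n => (a n).2) hS⟩
  -- The sequence is compatible: p_k a_n p_k = a_k as soon as n ≥ k, so the weak limit inherits all
  -- these compressions.
  have hz : ∀ k, D.proj k * z * D.proj k = a k := by
    intro k
    refine Subtype.ext (((hS.const_mul (D.proj k : K →L[ℂ] K)).mul_const
      (D.proj k : K →L[ℂ] K)).unique ?_)
    refine fun ξ η => (tendsto_const_nhds (x := inner ℂ η ((a k : K →L[ℂ] K) ξ))).congr' ?_
    filter_upwards [hVtop (Filter.eventually_ge_atTop k)] with n hn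
    obtain ⟨n, rfl⟩ := Nat.exists_eq_add_of_le hn
    have h : D.proj k * a (k + n) * D.proj k = a k := by
      simp only [ha]
      rw [mul_smul_comm, smul_mul_assoc, D.proj_mul_iterate_corner_mul_proj hτ hx, smul_smul,
        pow_add, mul_inv, inv_mul_cancel_right₀ (pow_ne_zero _ hc0)]
    rw [← h]
    rfl
  have hθa : ∀ n, D.θ (a n) = c • a (n + 1) := by
    intro n
    simp only [ha, map_smul, ← Function.iterate_succ_apply', smul_smul]
    rw [pow_succ', mul_inv, mul_inv_cancel_left₀ hc0]
  have htail : ∀ T : K →L[ℂ] K, TendstoWOT (fun n => (D.proj (n + 1) : K →L[ℂ] K) * T *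
      (D.proj (n + 1) : K →L[ℂ] K)) Filter.atTop T := fun T ξ η =>
    (D.tendstoWOT_proj_mul_mul_proj hτ le_rfl tendsto_const_nhds ξ η).comp
      (Filter.tendsto_add_atTop_nat 1)
  refine ⟨z, ?_, ?_⟩
  · refine Subtype.ext ((htail (D.θ z)).unique ?_)
    -- Applying θ to p_n z p_n = a_n gives the corner at p_(n+1), because θ(p_n) = p_(n+1).
    -- Agreement on all these corners determines an operator by `htail`.
    have h1 : ∀ n, D.proj (n + 1) * D.θ z * D.proj (n + 1) =
        D.proj (n + 1) * (c • z) * D.proj (n + 1) := by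
      intro n
      rw [mul_smul_comm, smul_mul_assoc, hz, ← hθa, ← hz n, map_mul, map_mul, theta_proj]
    have h2 : ∀ n, (D.proj (n + 1) : K →L[ℂ] K) * (D.θ z : K →L[ℂ] K) *
        (D.proj (n + 1) : K →L[ℂ] K) = (D.proj (n + 1) : K →L[ℂ] K) * ((c • z :) : K →L[ℂ] K) *
          (D.proj (n + 1) : K →L[ℂ] K) := fun n => congrArg Subtype.val (h1 n)
    simpa only [h2] using htail (c • z :)
  · have h := hz 0
    have h1 : a 0 = D.corner x := by simp [ha]
    rw [h1] at h
    exact (D.compression_corner_one_mul z).symm.trans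
      ((congrArg D.compression h).trans (D.compression_corner x))

variable {V : Ultrafilter ℕ} (hVtop : (V : Filter ℕ) ≤ Filter.atTop)
  (hV : ∀ p : ℕ → Prop, (∀ᶠ n in (V : Filter ℕ), p n) →
      ∀ᶠ n in (V : Filter ℕ), ∀ᶠ k in (V : Filter ℕ), p (n + k))
include hVtop hV

/-- For z in the span of eigenvectors, θ^n(z) → z in norm along V. Hence z is the weak limit of p_n
θ^n(z) p_n = θ^n(pzp), whose norm is at most that of the compression. -/
theorem norm_compression {z : D.B.toStarSubalgebra} (hz : z ∈ peripheralPoissonBoundary D.θ) :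
    ‖D.compression z‖ = ‖z‖ := by
  refine (D.norm_compression_le z).antisymm ?_
  have hspan : ∀ z ∈ Submodule.span ℂ (peripheralEigenvectors D.θ), ‖z‖ ≤ ‖D.compression z‖ := by
    intro z hz
    have h1 : Filter.Tendsto (fun n => D.θ^[n] z) V (nhds z) := by
      induction hz using Submodule.span_induction with
      | mem z hz =>
        obtain ⟨c, hc, hz⟩ := hz
        simpa only [D.iterate_eigenvector hz, one_smul] using
          (tendsto_pow_idempotent hV hc).smul_const z
      | zero =>
        have : ∀ n, D.θ^[n] 0 = 0 := fun n => iterate_map_zero D.θ n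
        simpa only [this] using tendsto_const_nhds
      | add z z' _ _ h h' =>
        have : ∀ n, D.θ^[n] (z + z') = D.θ^[n] z + D.θ^[n] z' := fun n => iterate_map_add D.θ n z z'
        simpa only [this] using h.add h'
      | smul c z _ h => simpa only [iterate_smul] using h.const_smul c
    have h2 := D.tendstoWOT_proj_mul_mul_proj hτ hVtop
      ((continuous_subtype_val.tendsto z).comp h1)
    refine h2.norm_le fun n => ?_
    have h3 : ‖D.proj n * D.θ^[n] z * D.proj n‖ ≤ ‖D.compression z‖ := by
      rw [proj_mul_iterate_mul_proj]
      exact (D.norm_iterate_le n _).trans (D.norm_corner_le _)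
    exact h3
  have hcl : IsClosed {z : D.B.toStarSubalgebra | ‖z‖ ≤ ‖D.compressionL z‖} :=
    isClosed_le continuous_norm D.compressionL.continuous.norm
  exact closure_minimal hspan hcl hz

theorem bijOn_compression : Set.BijOn D.compression (peripheralPoissonBoundary D.θ)
    (peripheralPoissonBoundary τ) := by
  refine ⟨?_, ?_, ?_⟩
  · have h : peripheralPoissonBoundary D.θ ≤
        (peripheralPoissonBoundary τ).comap D.compressionL.toLinearMap :=
      peripheralPoissonBoundary_le
        (isClosed_peripheralPoissonBoundary.preimage D.compressionL.continuous)
        fun c z hc hz => mem_peripheralPoissonBoundary hc (D.compression_eigenvector hτ hz)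
    exact h
  · intro z hz z' hz' h
    have h1 := D.norm_compression hτ hVtop hV (Submodule.sub_mem _ hz hz')
    have h2 : D.compression (z - z') = 0 := by
      rw [← compressionL_apply, map_sub, compressionL_apply, compressionL_apply, h, sub_self]
    rw [h2, norm_zero] at h1
    exact sub_eq_zero.1 (norm_eq_zero.1 h1.symm)
  -- An isometry on a complete space has closed range, so for surjectivity it suffices to lift
  -- eigenvectors.
  · let ι : peripheralPoissonBoundary D.θ →ₗᵢ[ℂ] (F →L[ℂ] F) :=
      { toLinearMap := D.compressionL.toLinearMap ∘ₗ (peripheralPoissonBoundary D.θ).subtype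
        norm_map' := fun z => D.norm_compression hτ hVtop hV z.2 }
    have : CompleteSpace (peripheralPoissonBoundary D.θ) :=
      isClosed_peripheralPoissonBoundary.completeSpace_coe
    have h : peripheralPoissonBoundary τ ≤ LinearMap.range ι.toLinearMap := by
      refine peripheralPoissonBoundary_le ?_ fun c x hc hx => ?_
      · exact ι.isometry.isClosedEmbedding.isClosed_range
      · obtain ⟨z, hz, hzx⟩ := D.exists_lift_eigenvector hτ hVtop hc hx
        exact ⟨⟨z, mem_peripheralPoissonBoundary hc hz⟩, hzx⟩
    intro x hx
    obtain ⟨z, hz⟩ := h hx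
    exact ⟨z, z.2, hz⟩

/-- With T the compression, T(z)T(z') = T(z p z'), so τ^n sends it to (cd)^n T(z p_n z'). Now p_n →
1 strongly and (cd)^n → 1 along V. -/
theorem ultraLimit_compression_mul_of_eigenvector {c d : ℂ} (hc : ‖c‖ = 1) (hd : ‖d‖ = 1)
    {z z' : D.B.toStarSubalgebra} (hz : D.θ z = c • z) (hz' : D.θ z' = d • z') :
    ultraLimit V τ (D.compression z * D.compression z') = D.compression (z * z') := by
  refine ultraLimit_eq hτ ?_
  have h1 : ∀ n, τ^[n] (D.compression z * D.compression z') =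
      (c * d) ^ n • D.compression (z * D.proj n * z') := by
    intro n
    have hp : D.corner 1 * D.corner 1 = D.corner 1 := D.proj_mul_proj hτ (Nat.zero_le 0)
    have h2 : D.corner (D.compression z * D.compression z') =
        D.corner (D.compression (z * D.corner 1 * z')) := by
      rw [corner_mul, corner_compression, corner_compression, corner_compression]
      simp only [mul_assoc]
      rw [← mul_assoc (D.corner 1) (D.corner 1), hp]
    have h3 : D.compression z * D.compression z' = D.compression (z * D.corner 1 * z') := by
      have := congrArg D.compression h2
      rwa [compression_corner, compression_corner] at this
    rw [h3, ← D.compression_iterate hτ, iterate_mul, iterate_mul, D.iterate_eigenvector hz,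
      D.iterate_eigenvector hz', smul_mul_assoc, smul_mul_assoc, mul_smul_comm, smul_smul,
      ← mul_pow, ← compressionL_apply, map_smul]
    rfl
  simp only [h1]
  have h4 : TendstoWOT (fun n => D.compression (z * D.proj n * z')) V
      (D.compression (z * z')) := by
    refine TendstoWOT.of_strong fun ξ => ?_
    have h5 := (D.tendsto_proj hτ ((z' : K →L[ℂ] K) (D.V.toContinuousLinearMap ξ))).mono_left hVtop
    exact ((D.V.toContinuousLinearMap.adjoint ∘L (z : K →L[ℂ] K)).continuous.tendsto _).comp h5
  have h5 := h4.smul (tendsto_pow_idempotent hV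
    (c := c * d) (by rw [norm_mul, hc, hd, one_mul]))
  rwa [one_smul] at h5

theorem ultraLimit_compression_mul {z z' : D.B.toStarSubalgebra}
    (hz : z ∈ peripheralPoissonBoundary D.θ) (hz' : z' ∈ peripheralPoissonBoundary D.θ) :
    ultraLimit V τ (D.compression z * D.compression z') = D.compression (z * z') := by
  have key : ∀ (c : ℂ) (z : D.B.toStarSubalgebra), ‖c‖ = 1 → D.θ z = c • z →
      ∀ z' ∈ peripheralPoissonBoundary D.θ,
        ultraLimit V τ (D.compression z * D.compression z') = D.compression (z * z') := by
    intro c z hc hz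
    let f := (ultraLimitL V hτ) ∘L
      (ContinuousLinearMap.mul ℂ (F →L[ℂ] F) (D.compression z)) ∘L D.compressionL
    let g := D.compressionL ∘L (ContinuousLinearMap.mul ℂ D.B.toStarSubalgebra z)
    have h : peripheralPoissonBoundary D.θ ≤ LinearMap.eqLocus f.toLinearMap g.toLinearMap :=
      peripheralPoissonBoundary_le (isClosed_eq f.continuous g.continuous) fun d z' hd hz' =>
        D.ultraLimit_compression_mul_of_eigenvector hτ hVtop hV hc hd hz hz'
    exact fun z' hz' => h hz'
  let f := (ultraLimitL V hτ) ∘L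
    ((ContinuousLinearMap.mul ℂ (F →L[ℂ] F)).flip (D.compression z')) ∘L D.compressionL
  let g := D.compressionL ∘L ((ContinuousLinearMap.mul ℂ D.B.toStarSubalgebra).flip z')
  have h : peripheralPoissonBoundary D.θ ≤ LinearMap.eqLocus f.toLinearMap g.toLinearMap :=
    peripheralPoissonBoundary_le (isClosed_eq f.continuous g.continuous)
      fun c z hc hz => key c z hc hz z' hz'
  exact h hz

end MinimalDilation

/-! ### Strong limits of products of fixed points -/

section StrongLimits

variable {F : Type u} [NormedAddCommGroup F] [InnerProductSpace ℂ F] [CompleteSpace F]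

/-- Write A = b^*b. The inequality upgrades weak to strong convergence for bounded positive
operators tending to 0. -/
theorem ContinuousLinearMap.norm_apply_sq_le_of_nonneg {A : F →L[ℂ] F} (hA : 0 ≤ A) (ξ : F) :
    ‖A ξ‖ ^ 2 ≤ ‖A‖ * (inner ℂ ξ (A ξ)).re := by
  obtain ⟨b, rfl⟩ := CStarAlgebra.nonneg_iff_eq_star_mul_self.1 hA
  have h1 : inner ℂ ξ ((star b * b) ξ) = ((‖b ξ‖ ^ 2 : ℝ) : ℂ) := by
    rw [mul_apply_eq_comp, ContinuousLinearMap.star_eq_adjoint,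
      ContinuousLinearMap.adjoint_inner_right, inner_self_eq_norm_sq_to_K]
    simp
  have h2 : ‖(star b * b) ξ‖ ≤ ‖b‖ * ‖b ξ‖ := by
    rw [← norm_star b]
    exact (star b).le_opNorm (b ξ)
  rw [h1, Complex.ofReal_re, CStarRing.norm_star_mul_self]
  calc ‖(star b * b) ξ‖ ^ 2 ≤ (‖b‖ * ‖b ξ‖) ^ 2 := by gcongr
    _ = ‖b‖ * ‖b‖ * ‖b ξ‖ ^ 2 := by ring

/-- A bounded increasing sequence of operators converges strongly. -/
theorem exists_strong_limit_of_monotone {T : ℕ → F →L[ℂ] F} (hT : Monotone T) {C : ℝ}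
    (hC : ∀ n, ‖T n‖ ≤ C) :
    ∃ S : F →L[ℂ] F, ∀ ξ, Filter.Tendsto (fun n => T n ξ) Filter.atTop (nhds (S ξ)) := by
  obtain ⟨S, hS⟩ := exists_tendstoWOT (Filter.hyperfilter ℕ) T hC
  have hle : ((Filter.hyperfilter ℕ : Ultrafilter ℕ) : Filter ℕ) ≤ Filter.atTop := by
    rw [← Nat.cofinite_eq_atTop]
    exact Filter.hyperfilter_le_cofinite
  have hSn : ∀ n, 0 ≤ S - T n := fun n => (hS.sub (TendstoWOT.const (T n))).nonneg
    (hle ((Filter.eventually_ge_atTop n).mono fun k hk => sub_nonneg.2 (hT hk)))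
  have hnorm : ∀ n, ‖S - T n‖ ≤ C + C := fun n =>
    (norm_sub_le _ _).trans (add_le_add (hS.norm_le hC) (hC n))
  refine ⟨S, fun ξ => ?_⟩
  -- This sequence is decreasing and nonnegative, hence convergent; its limit is the one along the
  -- ultrafilter, namely 0.
  set f : ℕ → ℝ := fun n => (inner ℂ ξ ((S - T n) ξ)).re with hf
  have hanti : Antitone f := by
    intro n k hnk
    have h1 := ((ContinuousLinearMap.nonneg_iff_isPositive _).1
      (sub_nonneg.2 (hT hnk))).re_inner_nonneg_right ξ
    have h2 : (S - T n) ξ = (S - T k) ξ + (T k - T n) ξ := by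
      simp only [sub_apply]
      abel
    simp only [hf]
    rw [h2, inner_add_right, Complex.add_re]
    exact le_add_of_nonneg_right h1
  have hnonneg : ∀ n, 0 ≤ f n := fun n =>
    ((ContinuousLinearMap.nonneg_iff_isPositive _).1 (hSn n)).re_inner_nonneg_right ξ
  have hV : Filter.Tendsto f (Filter.hyperfilter ℕ) (nhds 0) := by
    have h1 := ((TendstoWOT.const S).sub hS) ξ ξ
    rw [sub_self] at h1
    have h2 := (Complex.continuous_re.tendsto _).comp h1
    rw [zero_apply, inner_zero_right, Complex.zero_re] at h2
    exact h2
  have hlim : Filter.Tendsto f Filter.atTop (nhds 0) := by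
    have h1 := tendsto_atTop_ciInf hanti ⟨0, by rintro _ ⟨n, rfl⟩; exact hnonneg n⟩
    rwa [tendsto_nhds_unique (h1.mono_left hle) hV] at h1
  have hsq : Filter.Tendsto (fun n => ‖(S - T n) ξ‖ ^ 2) Filter.atTop (nhds 0) := by
    have h1 := hlim.const_mul (C + C)
    rw [mul_zero] at h1
    refine squeeze_zero (fun n => by positivity) (fun n => ?_) h1
    exact (ContinuousLinearMap.norm_apply_sq_le_of_nonneg (hSn n) ξ).trans
      (mul_le_mul_of_nonneg_right (hnorm n) (hnonneg n))
  have hn : Filter.Tendsto (fun n => ‖(S - T n) ξ‖) Filter.atTop (nhds 0) := by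
    have h1 := (Real.continuous_sqrt.tendsto 0).comp hsq
    simpa [Function.comp_def, Real.sqrt_sq] using h1
  have h0 := tendsto_zero_iff_norm_tendsto_zero.2 hn
  have h1 := (tendsto_const_nhds (x := S ξ)).sub h0
  simpa using h1

variable {τ : (F →L[ℂ] F) → (F →L[ℂ] F)}

/-- For a fixed point the Schwarz inequality reads h^*h ≤ τ(h^*h), so the iterates increase. -/
theorem IsNormalSchwarzMap.exists_strong_limit_star_mul_self (hτ : IsNormalSchwarzMap τ)
    {h : F →L[ℂ] F} (hh : τ h = h) :
    ∃ S : F →L[ℂ] F, ∀ ξ,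
      Filter.Tendsto (fun n => (τ^[n] (star h * h)) ξ) Filter.atTop (nhds (S ξ)) := by
  refine exists_strong_limit_of_monotone (monotone_nat_of_le_succ fun n => ?_)
    (fun n => (hτ.iterate n).norm_le _)
  rw [Function.iterate_succ_apply]
  refine (hτ.iterate n).mono ?_
  have := hτ.schwarz h
  rwa [hh] at this

/-- Polarization: the elements h^* + c k with c = ±1, ±i are again fixed points. -/
theorem IsNormalSchwarzMap.exists_strong_limit_mul (hτ : IsNormalSchwarzMap τ)
    {h k : F →L[ℂ] F} (hh : τ h = h) (hk : τ k = k) :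
    ∃ S : F →L[ℂ] F, ∀ ξ,
      Filter.Tendsto (fun n => (τ^[n] (h * k)) ξ) Filter.atTop (nhds (S ξ)) := by
  have hs : τ (star h) = star h := by rw [hτ.map_star, hh]
  have hlim : ∀ c : ℂ, ∃ S : F →L[ℂ] F, ∀ ξ, Filter.Tendsto (fun n =>
      (τ^[n] (star (star h + c • k) * (star h + c • k))) ξ) Filter.atTop (nhds (S ξ)) :=
    fun c => hτ.exists_strong_limit_star_mul_self (by rw [hτ.map_add, hτ.map_smul, hs, hk])
  choose S hS using hlim
  have hpol : ∀ n, τ^[n] (h * k) = (1 / 4 : ℂ) •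
      ((τ^[n] (star (star h + (1 : ℂ) • k) * (star h + (1 : ℂ) • k)) -
        τ^[n] (star (star h + (-1 : ℂ) • k) * (star h + (-1 : ℂ) • k))) -
      Complex.I • (τ^[n] (star (star h + Complex.I • k) * (star h + Complex.I • k)) -
        τ^[n] (star (star h + (-Complex.I) • k) * (star h + (-Complex.I) • k)))) := by
    intro n
    rw [← (hτ.iterate n).map_sub, ← (hτ.iterate n).map_sub, ← (hτ.iterate n).map_smul,
      ← (hτ.iterate n).map_sub, ← (hτ.iterate n).map_smul]
    congr 1
    simp only [star_add, star_smul, star_star, star_neg, Complex.star_def, Complex.conj_I,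
      add_mul, mul_add, smul_mul_assoc, mul_smul_comm, smul_add, smul_sub, smul_smul, neg_smul,
      one_smul, neg_mul, mul_neg, Complex.I_mul_I, neg_neg, smul_neg]
    module
  refine ⟨(1 / 4 : ℂ) • ((S 1 - S (-1)) - Complex.I • (S Complex.I - S (-Complex.I))), fun ξ => ?_⟩
  simp only [hpol, smul_apply, sub_apply]
  exact (((hS 1 ξ).sub (hS (-1) ξ)).sub
    (((hS Complex.I ξ).sub (hS (-Complex.I) ξ)).const_smul _)).const_smul _

end StrongLimits

/-! ### Operators given on an orthonormal basis -/

namespace HilbertBasis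

variable {ι : Type*} {F : Type u} [NormedAddCommGroup F] [InnerProductSpace ℂ F]
  (b : HilbertBasis ι ℂ F)

theorem clm_ext {A B : F →L[ℂ] F} (h : ∀ i, A (b i) = B (b i)) : A = B := by
  refine ContinuousLinearMap.ext_on
    (Submodule.dense_iff_topologicalClosure_eq_top.2 b.dense_span) ?_
  rintro _ ⟨i, rfl⟩
  exact h i

theorem ext_inner {ξ η : F} (h : ∀ i, inner ℂ (b i) ξ = inner ℂ (b i) η) : ξ = η := by
  refine b.repr.injective ?_
  ext i
  rw [b.repr_apply_apply, b.repr_apply_apply, h]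

variable [CompleteSpace F]

/-- The isometry which maps an orthonormal basis to a given orthonormal family. -/
noncomputable def toIsometry {v : ι → F} (hv : Orthonormal ℂ v) : F →L[ℂ] F :=
  (hv.orthogonalFamily.linearIsometry.comp b.repr.toLinearIsometry).toContinuousLinearMap

theorem toIsometry_apply {v : ι → F} (hv : Orthonormal ℂ v) (i : ι) :
    b.toIsometry hv (b i) = v i := by
  classical
  change hv.orthogonalFamily.linearIsometry (b.repr (b i)) = v i
  rw [b.repr_self, OrthogonalFamily.linearIsometry_apply_single]
  simp

theorem inner_toIsometry {v : ι → F} (hv : Orthonormal ℂ v) (ξ η : F) :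
    inner ℂ (b.toIsometry hv ξ) (b.toIsometry hv η) = inner ℂ ξ η :=
  (hv.orthogonalFamily.linearIsometry.comp b.repr.toLinearIsometry).inner_map_map ξ η

theorem star_toIsometry_mul_self {v : ι → F} (hv : Orthonormal ℂ v) :
    star (b.toIsometry hv) * b.toIsometry hv = 1 := by
  refine ContinuousLinearMap.ext fun ξ => ext_inner_left ℂ fun η => ?_
  rw [mul_apply_eq_comp, ContinuousLinearMap.star_eq_adjoint,
    ContinuousLinearMap.adjoint_inner_right, inner_toIsometry]
  rfl

end HilbertBasis

/-! ### Averages over isometries -/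

section IsometryAverage

variable {F : Type u} [NormedAddCommGroup F] [InnerProductSpace ℂ F] [CompleteSpace F]
  {Θ : Type v}

/-- The map `x ↦ ∑ ω_i l_i^* x l_i`. -/
noncomputable def isometryAverage (l : Θ → F →L[ℂ] F) (ω : Θ → ℝ) (x : F →L[ℂ] F) : F →L[ℂ] F :=
  ∑' i, (ω i : ℂ) • (star (l i) * x * l i)

theorem ContinuousLinearMap.norm_le_one_of_star_mul_self {l : F →L[ℂ] F} (hl : star l * l = 1) :
    ‖l‖ ≤ 1 := by
  have h1 := CStarRing.norm_star_mul_self (x := l)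
  rw [hl] at h1
  have h2 : ‖(1 : F →L[ℂ] F)‖ ≤ 1 := ContinuousLinearMap.norm_id_le
  nlinarith [norm_nonneg l]

variable {l : Θ → F →L[ℂ] F} (hl : ∀ i, star (l i) * l i = 1)
  {ω : Θ → ℝ} (hpos : ∀ i, 0 < ω i) (hsum : HasSum ω 1)

omit [CompleteSpace F] in
include hsum in
theorem hasSum_smul_operator (A : F →L[ℂ] F) : HasSum (fun i => (ω i : ℂ) • A) A := by
  simpa using (Complex.hasSum_ofReal.2 hsum).smul_const A

include hl hpos hsum

omit hsum in
theorem norm_isometryAverage_term_le (x : F →L[ℂ] F) (i : Θ) :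
    ‖(ω i : ℂ) • (star (l i) * x * l i)‖ ≤ ω i * ‖x‖ := by
  rw [norm_smul, Complex.norm_real, Real.norm_of_nonneg (hpos i).le]
  refine mul_le_mul_of_nonneg_left ?_ (hpos i).le
  have h1 := ContinuousLinearMap.norm_le_one_of_star_mul_self (hl i)
  calc ‖star (l i) * x * l i‖
      ≤ ‖star (l i)‖ * ‖x‖ * ‖l i‖ := norm_mul₃_le
    _ ≤ 1 * ‖x‖ * 1 := by
        rw [norm_star]
        gcongr
    _ = ‖x‖ := by ring

theorem hasSum_isometryAverage (x : F →L[ℂ] F) :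
    HasSum (fun i => (ω i : ℂ) • (star (l i) * x * l i))
      (isometryAverage l ω x) :=
  (Summable.of_norm_bounded (hsum.summable.mul_right ‖x‖)
    (norm_isometryAverage_term_le hl hpos x)).hasSum

theorem isometryAverage_add (x y : F →L[ℂ] F) :
    isometryAverage l ω (x + y) = isometryAverage l ω x + isometryAverage l ω y := by
  refine (hasSum_isometryAverage hl hpos hsum _).unique ?_
  simpa only [mul_add, add_mul, smul_add] using
    (hasSum_isometryAverage hl hpos hsum x).add (hasSum_isometryAverage hl hpos hsum y)

theorem isometryAverage_smul (c : ℂ) (x : F →L[ℂ] F) :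
    isometryAverage l ω (c • x) = c • isometryAverage l ω x := by
  refine (hasSum_isometryAverage hl hpos hsum _).unique ?_
  simpa only [mul_smul_comm, smul_mul_assoc, smul_comm c] using
    (hasSum_isometryAverage hl hpos hsum x).const_smul c

theorem isometryAverage_star (x : F →L[ℂ] F) :
    isometryAverage l ω (star x) = star (isometryAverage l ω x) := by
  refine (hasSum_isometryAverage hl hpos hsum _).unique ?_
  simpa only [star_smul, star_mul, star_star, Complex.star_def, Complex.conj_ofReal, mul_assoc]
    using (hasSum_isometryAverage hl hpos hsum x).star

theorem isometryAverage_one : isometryAverage l ω (1 : F →L[ℂ] F) = 1 := by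
  refine (hasSum_isometryAverage hl hpos hsum _).unique ?_
  simpa only [mul_one, hl] using
    hasSum_smul_operator hsum (1 : F →L[ℂ] F)

theorem norm_isometryAverage_le (x : F →L[ℂ] F) : ‖isometryAverage l ω x‖ ≤ ‖x‖ := by
  have h := hsum.mul_right ‖x‖
  rw [one_mul] at h
  exact tsum_of_norm_bounded h (norm_isometryAverage_term_le hl hpos x)

/-- With t the average of x, the defect is the sum of ω_i (x l_i - l_i t)^*(x l_i - l_i t), by l_i^*
l_i = 1 and ∑ ω_i = 1. -/
theorem isometryAverage_schwarz (x : F →L[ℂ] F) :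
    star (isometryAverage l ω x) * isometryAverage l ω x ≤ isometryAverage l ω (star x * x) := by
  set t := isometryAverage l ω x with ht
  have h1 := (((hasSum_isometryAverage hl hpos hsum (star x * x)).sub
    ((hasSum_isometryAverage hl hpos hsum (star x)).mul_right t)).sub
    ((hasSum_isometryAverage hl hpos hsum x).mul_left (star t))).add
    (hasSum_smul_operator hsum (star t * t))
  rw [isometryAverage_star hl hpos hsum, ← ht, sub_add_cancel] at h1
  rw [← sub_nonneg]
  refine h1.nonneg fun i => ?_
  have h2 : 0 ≤ (ω i : ℂ) • (star (x * l i - l i * t) *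
      (x * l i - l i * t)) := by
    rw [ContinuousLinearMap.nonneg_iff_isPositive]
    exact ((ContinuousLinearMap.nonneg_iff_isPositive _).1 (star_mul_self_nonneg _)).smul_of_nonneg
      (Complex.zero_le_real.2 (hpos i).le)
  refine h2.trans_eq ?_
  have h4 : star t * star (l i) * (l i * t) = star t * t := by
    rw [mul_assoc, ← mul_assoc (star (l i)), hl, one_mul]
  simp only [star_sub, star_mul, sub_mul, mul_sub, smul_sub, h4, smul_mul_assoc, mul_smul_comm]
  simp only [mul_assoc]
  abel

/-- Dominated convergence for the sum over i: the weights ω_i are summable and the sequence is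
bounded. -/
theorem isometryAverage_normal {f : Filter ℕ} {T : ℕ → F →L[ℂ] F}
    {S : F →L[ℂ] F} {C : ℝ} (hT : ∀ n, ‖T n‖ ≤ C) (h : TendstoWOT T f S) :
    TendstoWOT (fun n => isometryAverage l ω (T n)) f (isometryAverage l ω S) := by
  intro ξ η
  have hinner : ∀ x : F →L[ℂ] F, inner ℂ η (isometryAverage l ω x ξ) =
      ∑' i, inner ℂ η (((ω i : ℂ) •
        (star (l i) * x * l i)) ξ) := by
    intro x
    exact ((((hasSum_isometryAverage hl hpos hsum x).mapL
      (ContinuousLinearMap.apply ℂ (F) ξ)).mapL (innerSL ℂ η)).tsum_eq).symm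
  simp only [hinner]
  refine tendsto_tsum_of_dominated_convergence
    (bound := fun i => ‖η‖ * (ω i * C * ‖ξ‖)) ?_ (fun i => ?_) (Filter.Eventually.of_forall ?_)
  · exact ((hsum.summable.mul_right C).mul_right ‖ξ‖).mul_left ‖η‖
  · exact (((h.const_mul _).mul_const _).smul tendsto_const_nhds) ξ η
  · intro n i
    refine (norm_inner_le_norm _ _).trans ?_
    gcongr
    refine ContinuousLinearMap.le_of_opNorm_le _ ?_ ξ
    exact (norm_isometryAverage_term_le hl hpos (T n) i).trans
      (mul_le_mul_of_nonneg_left (hT n) (hpos i).le)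

theorem isNormalSchwarzMap_isometryAverage : IsNormalSchwarzMap (isometryAverage l ω) where
  map_add := isometryAverage_add hl hpos hsum
  map_smul := isometryAverage_smul hl hpos hsum
  map_one := isometryAverage_one hl hpos hsum
  map_star := isometryAverage_star hl hpos hsum
  norm_le := norm_isometryAverage_le hl hpos hsum
  schwarz := isometryAverage_schwarz hl hpos hsum
  normal := isometryAverage_normal hl hpos hsum

/-- At x = 1 this says that B itself is an eigenvector with eigenvalue d. -/
theorem isometryAverage_mul_right {B : F →L[ℂ] F} {d : ℂ}
    (hB : ∀ i, B * l i = d • (l i * B))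
    (x : F →L[ℂ] F) : isometryAverage l ω (x * B) = d • (isometryAverage l ω x * B) := by
  refine (hasSum_isometryAverage hl hpos hsum _).unique ?_
  have h := ((hasSum_isometryAverage hl hpos hsum x).mul_right B).const_smul d
  have h1 : ∀ i, star (l i) * (x * B) * l i =
      d • (star (l i) * x * l i * B) := by
    intro i
    rw [← mul_assoc, mul_assoc, hB, mul_smul_comm, ← mul_assoc]
  simpa only [h1, smul_mul_assoc, smul_comm d] using h

theorem isometryAverage_mul_left {A : F →L[ℂ] F} {c : ℂ}
    (hA : ∀ i, star (l i) * A = c • (A * star (l i)))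
    (x : F →L[ℂ] F) : isometryAverage l ω (A * x) = c • (A * isometryAverage l ω x) := by
  refine (hasSum_isometryAverage hl hpos hsum _).unique ?_
  have h := ((hasSum_isometryAverage hl hpos hsum x).mul_left A).const_smul c
  have h1 : ∀ i, star (l i) * (A * x) * l i =
      c • (A * (star (l i) * x * l i)) := by
    intro i
    rw [← mul_assoc, hA, smul_mul_assoc, smul_mul_assoc, mul_assoc A, mul_assoc A]
  simpa only [h1, mul_smul_comm, smul_comm c] using h

theorem iterate_isometryAverage_mul_right {B : F →L[ℂ] F} {d : ℂ}
    (hB : ∀ i, B * l i = d • (l i * B))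
    (x : F →L[ℂ] F) (n : ℕ) :
    (isometryAverage l ω)^[n] (x * B) = d ^ n • ((isometryAverage l ω)^[n] x * B) := by
  induction n with
  | zero => simp
  | succ n ih =>
    rw [Function.iterate_succ_apply', ih, isometryAverage_smul hl hpos hsum, isometryAverage_mul_right hl hpos hsum hB,
      smul_smul, ← pow_succ, Function.iterate_succ_apply']

theorem iterate_isometryAverage_mul_left {A : F →L[ℂ] F} {c : ℂ}
    (hA : ∀ i, star (l i) * A = c • (A * star (l i)))
    (x : F →L[ℂ] F) (n : ℕ) :
    (isometryAverage l ω)^[n] (A * x) = c ^ n • (A * (isometryAverage l ω)^[n] x) := by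
  induction n with
  | zero => simp
  | succ n ih =>
    rw [Function.iterate_succ_apply', ih, isometryAverage_smul hl hpos hsum, isometryAverage_mul_left hl hpos hsum hA,
      smul_smul, ← pow_succ, Function.iterate_succ_apply']

section UltraLimit

variable {V : Ultrafilter ℕ}
  (hV : ∀ p : ℕ → Prop, (∀ᶠ n in (V : Filter ℕ), p n) →
      ∀ᶠ n in (V : Filter ℕ), ∀ᶠ k in (V : Filter ℕ), p (n + k))
include hV

/-- Each application of the map costs a factor d, and d^n → 1 along V, so Φ is an honest right
module map over such B. -/
theorem ultraLimit_isometryAverage_mul_right {B : F →L[ℂ] F} {d : ℂ} (hd : ‖d‖ = 1)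
    (hB : ∀ i, B * l i = d • (l i * B))
    (x : F →L[ℂ] F) :
    ultraLimit V (isometryAverage l ω) (x * B) = ultraLimit V (isometryAverage l ω) x * B := by
  have hτ := isNormalSchwarzMap_isometryAverage hl hpos hsum
  refine ultraLimit_eq hτ ?_
  simpa only [iterate_isometryAverage_mul_right hl hpos hsum hB, one_smul] using
    ((ultraLimit_spec V hτ x).mul_const B).smul (tendsto_pow_idempotent hV hd)

theorem ultraLimit_isometryAverage_mul_left {A : F →L[ℂ] F} {c : ℂ} (hc : ‖c‖ = 1)
    (hA : ∀ i, star (l i) * A = c • (A * star (l i)))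
    (x : F →L[ℂ] F) :
    ultraLimit V (isometryAverage l ω) (A * x) = A * ultraLimit V (isometryAverage l ω) x := by
  have hτ := isNormalSchwarzMap_isometryAverage hl hpos hsum
  refine ultraLimit_eq hτ ?_
  simpa only [iterate_isometryAverage_mul_left hl hpos hsum hA, one_smul] using
    ((ultraLimit_spec V hτ x).const_mul A).smul (tendsto_pow_idempotent hV hc)

end UltraLimit

end IsometryAverage

/-! ### Gauge unitaries and right creation operators -/

section WordBasis

variable {F : Type u} [NormedAddCommGroup F] [InnerProductSpace ℂ F] [CompleteSpace F]
  {Θ : Type v} (b : HilbertBasis (List Θ) ℂ F)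

omit [CompleteSpace F] in
theorem orthonormal_gaugeUnitary {c : ℂ} (hc : ‖c‖ = 1) :
    Orthonormal ℂ (fun w : List Θ => c ^ w.length • b w) := by
  refine ⟨fun w => by rw [norm_smul, norm_pow, hc, one_pow, one_mul, b.orthonormal.1 w], ?_⟩
  intro v w hvw
  rw [inner_smul_left, inner_smul_right, b.orthonormal.2 hvw, mul_zero, mul_zero]

/-- The gauge unitary, which multiplies words of length `n` by `c ^ n`. -/
noncomputable def gaugeUnitary {c : ℂ} (hc : ‖c‖ = 1) : F →L[ℂ] F :=
  b.toIsometry (orthonormal_gaugeUnitary b hc)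

theorem gaugeUnitary_apply {c : ℂ} (hc : ‖c‖ = 1) (w : List Θ) :
    gaugeUnitary b hc (b w) = c ^ w.length • b w :=
  b.toIsometry_apply _ w

theorem gaugeUnitary_mul_gaugeUnitary {c d : ℂ} (hc : ‖c‖ = 1) (hd : ‖d‖ = 1) (hcd : c * d = 1) :
    gaugeUnitary b hc * gaugeUnitary b hd = 1 := by
  refine b.clm_ext fun w => ?_
  rw [mul_apply_eq_comp, gaugeUnitary_apply, map_smul, gaugeUnitary_apply, smul_smul, ← mul_pow, mul_comm, hcd,
    one_pow, one_smul]
  rfl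

theorem star_gaugeUnitary {c d : ℂ} (hc : ‖c‖ = 1) (hd : ‖d‖ = 1) (hcd : c * d = 1) :
    star (gaugeUnitary b hc) = gaugeUnitary b hd := by
  have h1 : star (gaugeUnitary b hc) * gaugeUnitary b hc = 1 := b.star_toIsometry_mul_self _
  rw [← mul_one (star _), ← gaugeUnitary_mul_gaugeUnitary b hc hd hcd, ← mul_assoc, h1, one_mul]

omit [CompleteSpace F] in
theorem orthonormal_rightCreation (j : Θ) : Orthonormal ℂ (fun w : List Θ => b (w ++ [j])) :=
  b.orthonormal.comp _ (fun _ _ h => List.append_cancel_right h)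

/-- The right creation operator of the letter `j`. -/
noncomputable def rightCreation (j : Θ) : F →L[ℂ] F :=
  b.toIsometry (orthonormal_rightCreation b j)

theorem rightCreation_apply (j : Θ) (w : List Θ) : rightCreation b j (b w) = b (w ++ [j]) :=
  b.toIsometry_apply _ w

theorem star_rightCreation_mul [DecidableEq Θ] (k j : Θ) :
    star (rightCreation b k) * rightCreation b j =
      (if k = j then 1 else 0 : ℂ) • (1 : F →L[ℂ] F) := by
  refine b.clm_ext fun w => b.ext_inner fun v => ?_
  rw [mul_apply_eq_comp, ContinuousLinearMap.star_eq_adjoint,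
    ContinuousLinearMap.adjoint_inner_right, rightCreation_apply, rightCreation_apply,
    smul_apply, inner_smul_right, one_apply_eq_self, orthonormal_iff_ite.1 b.orthonormal,
    orthonormal_iff_ite.1 b.orthonormal]
  by_cases h1 : v = w <;> by_cases h2 : k = j <;> simp [h1, h2]

variable {b} {l : Θ → F →L[ℂ] F} (hlb : ∀ i w, l i (b w) = b (i :: w))
include hlb

theorem gaugeUnitary_mul_creation {c : ℂ} (hc : ‖c‖ = 1) (i : Θ) :
    gaugeUnitary b hc * l i = c • (l i * gaugeUnitary b hc) := by
  refine b.clm_ext fun w => ?_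
  rw [mul_apply_eq_comp, smul_apply, mul_apply_eq_comp, hlb, gaugeUnitary_apply, gaugeUnitary_apply, map_smul,
    hlb, smul_smul, List.length_cons, pow_succ']

theorem star_creation_mul_gaugeUnitary {c : ℂ} (hc : ‖c‖ = 1) (i : Θ) :
    star (l i) * gaugeUnitary b hc = c • (gaugeUnitary b hc * star (l i)) := by
  have hd : ‖star c‖ = 1 := by rw [norm_star, hc]
  have hcd : star c * c = 1 := by
    rw [Complex.star_def, mul_comm, Complex.mul_conj, Complex.normSq_eq_norm_sq, hc]
    simp
  have h := congrArg star (gaugeUnitary_mul_creation hlb hd i)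
  rwa [star_mul, star_smul, star_mul, star_star, star_gaugeUnitary b hd hc hcd] at h

theorem rightCreation_mul_creation (j i : Θ) :
    rightCreation b j * l i = (1 : ℂ) • (l i * rightCreation b j) := by
  refine b.clm_ext fun w => ?_
  rw [one_smul, mul_apply_eq_comp, mul_apply_eq_comp, hlb, rightCreation_apply,
    rightCreation_apply, hlb, List.cons_append]

/-- On the left only r_j^* can be pulled out: r_j does not commute with l_j^*, as their products in
the two orders differ on the vacuum. -/
theorem star_creation_mul_star_rightCreation (j i : Θ) :
    star (l i) * star (rightCreation b j) =
      (1 : ℂ) • (star (rightCreation b j) * star (l i)) := by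
  have h := congrArg star (rightCreation_mul_creation hlb j i)
  rw [one_smul, star_mul, star_mul] at h
  rw [one_smul, h]

omit hlb in
/-- An operator which commutes with the gauge unitaries, and whose compressions by right creation
operators are trivial, is a scalar. -/
theorem eq_smul_one_of_gauge_invariant [DecidableEq Θ] {x : F →L[ℂ] F}
    (hg : ∀ (c : ℂ) (hc : ‖c‖ = 1), x * gaugeUnitary b hc = gaugeUnitary b hc * x)
    (hr : ∀ k j, star (rightCreation b k) * x * rightCreation b j =
      (if k = j then 1 else 0 : ℂ) • x) :
    x = inner ℂ (b []) (x (b [])) • (1 : F →L[ℂ] F) := by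
  have hlen : ∀ v w : List Θ, v.length ≠ w.length → inner ℂ (b v) (x (b w)) = 0 := by
    intro v w hvw
    have hN : v.length + w.length + 1 ≠ 0 := Nat.succ_ne_zero _
    -- A primitive root of unity whose order exceeds both lengths, so its powers at the two lengths
    -- differ.
    set c := Complex.exp (2 * Real.pi * Complex.I / (v.length + w.length + 1 : ℕ)) with hcdef
    have hprim : IsPrimitiveRoot c (v.length + w.length + 1) := Complex.isPrimitiveRoot_exp _ hN
    have hc : ‖c‖ = 1 := hprim.norm'_eq_one hN
    have hc1 : c * star c = 1 := by
      rw [Complex.star_def, Complex.mul_conj, Complex.normSq_eq_norm_sq, hc]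
      simp
    have h1 := congrArg (fun A : F →L[ℂ] F => inner ℂ (b v) (A (b w))) (hg c hc)
    simp only [mul_apply_eq_comp, gaugeUnitary_apply, map_smul, inner_smul_right] at h1
    have h2 : inner ℂ (b v) (gaugeUnitary b hc (x (b w))) = c ^ v.length * inner ℂ (b v) (x (b w)) := by
      rw [← ContinuousLinearMap.adjoint_inner_left, ← ContinuousLinearMap.star_eq_adjoint,
        star_gaugeUnitary b hc (by rw [norm_star, hc]) hc1, gaugeUnitary_apply, inner_smul_left, map_pow,
        Complex.star_def, Complex.conj_conj]
    rw [h2] at h1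
    by_contra h0
    exact hvw (hprim.pow_inj (by omega) (by omega) (mul_right_cancel₀ h0 h1)).symm
  -- Strip the last letters of both words together until one is empty; the other is then empty too
  -- or has a different length.
  have hcoef : ∀ v w : List Θ, inner ℂ (b v) (x (b w)) =
      if v = w then inner ℂ (b []) (x (b [])) else 0 := by
    intro v
    induction v using List.reverseRecOn with
    | nil =>
      intro w
      rcases w with _ | ⟨i, w⟩
      · simp
      · rw [if_neg (by simp)]
        exact hlen _ _ (by simp)
    | append_singleton v k ih =>
      intro w
      rcases List.eq_nil_or_concat w with rfl | ⟨w, j, rfl⟩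
      · rw [if_neg (by simp)]
        exact hlen _ _ (by simp)
      · have h1 : inner ℂ (b (v ++ [k])) (x (b (w ++ [j]))) =
            inner ℂ (b v) ((star (rightCreation b k) * x * rightCreation b j) (b w)) := by
          rw [mul_apply_eq_comp, mul_apply_eq_comp, ContinuousLinearMap.star_eq_adjoint,
            ContinuousLinearMap.adjoint_inner_right, rightCreation_apply, rightCreation_apply]
        rw [List.concat_eq_append, h1, hr, smul_apply, inner_smul_right, ih w]
        by_cases h2 : v = w <;> by_cases h3 : k = j <;> simp [h2, h3]
  refine b.clm_ext fun w => b.ext_inner fun v => ?_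
  rw [hcoef, smul_apply, one_apply_eq_self, inner_smul_right,
    orthonormal_iff_ite.1 b.orthonormal]
  split_ifs <;> simp

variable (hl : ∀ i, star (l i) * l i = 1)
  {ω : Θ → ℝ} (hpos : ∀ i, 0 < ω i) (hsum : HasSum ω 1)
include hl hpos hsum

/-- With U the gauge unitaries, h = U_{c̄} x and k = y U_{d̄} are fixed points and xy = U_c (hk)
U_d. Pulling U_c and U_d out of the n-th iterate produces exactly (cd)^n, which the normalization
cancels. -/
theorem hasPeripheralLimits_isometryAverage : HasPeripheralLimits (isometryAverage l ω) := by
  intro c d x y hc hd hx hy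
  have hτ := isNormalSchwarzMap_isometryAverage hl hpos hsum
  have hinv : ∀ {c : ℂ}, ‖c‖ = 1 → ‖star c‖ = 1 ∧ c * star c = 1 ∧ star c * c = 1 := by
    intro c hc
    have h : c * star c = 1 := by
      rw [Complex.star_def, Complex.mul_conj, Complex.normSq_eq_norm_sq, hc]
      simp
    exact ⟨by rw [norm_star, hc], h, by rw [mul_comm, h]⟩
  obtain ⟨hc', hc1, hc2⟩ := hinv hc
  obtain ⟨hd', hd1, hd2⟩ := hinv hd
  have hh : isometryAverage l ω (gaugeUnitary b hc' * x) = gaugeUnitary b hc' * x := by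
    rw [isometryAverage_mul_left hl hpos hsum (star_creation_mul_gaugeUnitary hlb hc'), hx,
      mul_smul_comm, smul_smul, hc2, one_smul]
  have hk : isometryAverage l ω (y * gaugeUnitary b hd') = y * gaugeUnitary b hd' := by
    rw [isometryAverage_mul_right hl hpos hsum (gaugeUnitary_mul_creation hlb hd'), hy,
      smul_mul_assoc, smul_smul, hd2, one_smul]
  obtain ⟨S, hS⟩ := hτ.exists_strong_limit_mul hh hk
  refine ⟨gaugeUnitary b hc * S * gaugeUnitary b hd, fun ξ => ?_⟩
  have hxy : x * y = gaugeUnitary b hc * (gaugeUnitary b hc' * x * (y * gaugeUnitary b hd')) * gaugeUnitary b hd := by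
    have h1 : gaugeUnitary b hc * (gaugeUnitary b hc' * x * (y * gaugeUnitary b hd')) * gaugeUnitary b hd =
        gaugeUnitary b hc * gaugeUnitary b hc' * (x * y) * (gaugeUnitary b hd' * gaugeUnitary b hd) := by
      simp only [mul_assoc]
    rw [h1, gaugeUnitary_mul_gaugeUnitary b hc hc' hc1, gaugeUnitary_mul_gaugeUnitary b hd' hd hd2, one_mul, mul_one]
  have hcd0 : c * d ≠ 0 := norm_ne_zero_iff.1 (by rw [norm_mul, hc, hd]; norm_num)
  have hiter : ∀ n, ((c * d) ^ n)⁻¹ • ((isometryAverage l ω)^[n] (x * y)) =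
      gaugeUnitary b hc * (isometryAverage l ω)^[n] (gaugeUnitary b hc' * x * (y * gaugeUnitary b hd')) *
        gaugeUnitary b hd := by
    intro n
    rw [hxy, iterate_isometryAverage_mul_right hl hpos hsum (gaugeUnitary_mul_creation hlb hd),
      iterate_isometryAverage_mul_left hl hpos hsum (star_creation_mul_gaugeUnitary hlb hc),
      smul_mul_assoc, smul_smul, smul_smul, mul_assoc (_⁻¹ : ℂ), ← mul_pow, mul_comm d c,
      inv_mul_cancel₀ (pow_ne_zero _ hcd0), one_smul]
  have hlim := ((gaugeUnitary b hc).continuous.tendsto _).comp (hS (gaugeUnitary b hd ξ))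
  refine hlim.congr fun n => ?_
  exact (congrArg (fun A : F →L[ℂ] F => A ξ) (hiter n)).symm

/-- Testing centrality on gauge unitaries and right creation operators suffices, since Φ is explicit
on products with them. -/
theorem eq_smul_one_of_ultraLimit_commute {V : Ultrafilter ℕ}
    (hV : ∀ p : ℕ → Prop, (∀ᶠ n in (V : Filter ℕ), p n) →
      ∀ᶠ n in (V : Filter ℕ), ∀ᶠ k in (V : Filter ℕ), p (n + k)) {x : F →L[ℂ] F}
    (hx : ultraLimit V (isometryAverage l ω) x = x)
    (hcomm : ∀ y ∈ peripheralPoissonBoundary (isometryAverage l ω),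
      ultraLimit V (isometryAverage l ω) (x * y) = ultraLimit V (isometryAverage l ω) (y * x)) :
    ∃ c : ℂ, x = c • (1 : F →L[ℂ] F) := by
  classical
  have hτ := isNormalSchwarzMap_isometryAverage hl hpos hsum
  have hmem : ∀ {B : F →L[ℂ] F} {d : ℂ}, ‖d‖ = 1 → (∀ i, B * l i = d • (l i * B)) →
      B ∈ peripheralPoissonBoundary (isometryAverage l ω) := by
    intro B d hd hB
    refine mem_peripheralPoissonBoundary hd ?_
    have h := isometryAverage_mul_right hl hpos hsum hB 1
    rwa [hτ.map_one, one_mul] at h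
  refine ⟨_, eq_smul_one_of_gauge_invariant (b := b) ?_ ?_⟩
  · intro c hc
    have h := hcomm _ (hmem hc (gaugeUnitary_mul_creation hlb hc))
    rwa [ultraLimit_isometryAverage_mul_right hl hpos hsum hV hc (gaugeUnitary_mul_creation hlb hc),
      ultraLimit_isometryAverage_mul_left hl hpos hsum hV hc (star_creation_mul_gaugeUnitary hlb hc),
      hx] at h
  -- Here x r_j = Φ(x r_j) = Φ(r_j x), and r_k^* can be moved inside Φ, where r_k^* r_j = δ_{kj}.
  · intro k j
    have h := hcomm _ (hmem norm_one (rightCreation_mul_creation hlb j))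
    rw [ultraLimit_isometryAverage_mul_right hl hpos hsum hV norm_one
      (rightCreation_mul_creation hlb j), hx] at h
    rw [mul_assoc, h, ← ultraLimit_isometryAverage_mul_left hl hpos hsum hV norm_one
      (star_creation_mul_star_rightCreation hlb k), ← mul_assoc, star_rightCreation_mul,
      smul_mul_assoc, one_mul, ultraLimit_smul hτ, hx]

end WordBasis

/-! ### Left creation operators as isometries, and the main theorem -/

section FockUCP

variable {H : Type u} [NormedAddCommGroup H] [InnerProductSpace ℂ H]
  {Θ : Type v} (e : HilbertBasis Θ ℂ H)

theorem star_leftCreation_mul_self (i : Θ) :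
    star (leftCreation (e i)) * leftCreation (e i) = 1 := by
  refine ContinuousLinearMap.ext fun ξ => ext_inner_left ℂ fun η => ?_
  rw [mul_apply_eq_comp, ContinuousLinearMap.star_eq_adjoint,
    ContinuousLinearMap.adjoint_inner_right, inner_leftCreation, inner_self_eq_norm_sq_to_K,
    e.orthonormal.1 i]
  simp

end FockUCP

theorem mainTheorem2 {H : Type u} [NormedAddCommGroup H] [InnerProductSpace ℂ H] [CompleteSpace H]
    {Θ : Type v} [Countable Θ] [Nontrivial Θ] (e : HilbertBasis Θ ℂ H)
    (ω : Θ → ℝ) (hpos : ∀ i, 0 < ω i) (hsum : HasSum ω 1) :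
    ∃ m : peripheralPoissonBoundary (fockUCP e ω) →L[ℂ]
        peripheralPoissonBoundary (fockUCP e ω) →L[ℂ] peripheralPoissonBoundary (fockUCP e ω),
      -- `m` is the modified Choi-Effros product, the only such operation
      IsModifiedChoiEffrosProduct (fockUCP e ω) m ∧
      (∀ m', IsModifiedChoiEffrosProduct (fockUCP e ω) m' → m' = m) ∧
      -- it is the product transported from any minimal dilation by the compression
      (∀ (K : Type w) [NormedAddCommGroup K] [InnerProductSpace ℂ K] [CompleteSpace K]
        (D : MinimalDilation (fockUCP e ω) K),
        Set.BijOn D.compression (peripheralPoissonBoundary D.θ)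
          (peripheralPoissonBoundary (fockUCP e ω)) ∧
        (∀ z ∈ peripheralPoissonBoundary D.θ, ‖D.compression z‖ = ‖z‖) ∧
        ∀ (x y : peripheralPoissonBoundary (fockUCP e ω)),
          ∀ z ∈ peripheralPoissonBoundary D.θ, ∀ z' ∈ peripheralPoissonBoundary D.θ,
          D.compression z = x → D.compression z' = y →
          (m x y : FullFock H →L[ℂ] FullFock H) = D.compression (z * z')) ∧
      -- it makes the peripheral Poisson boundary a unital C*-algebra
      IsUnitalCStarProduct (peripheralPoissonBoundary (fockUCP e ω)) m ∧
      -- whose center consists of the scalar multiples of the identity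
      ∀ x : peripheralPoissonBoundary (fockUCP e ω),
        (∀ y : peripheralPoissonBoundary (fockUCP e ω), m x y = m y x) ↔
          ∃ c : ℂ, (x : FullFock H →L[ℂ] FullFock H) = c • 1 := by
  obtain ⟨V, hVtop, hV⟩ := exists_idempotent_ultrafilter_nat
  have hl := star_leftCreation_mul_self e
  have hlb := leftCreation_fockBasis e
  -- `fockUCP` is definitionally the `isometryAverage` of the left creation operators, so the
  -- general results apply as they stand.
  have hτ : IsNormalSchwarzMap (fockUCP e ω) := isNormalSchwarzMap_isometryAverage hl hpos hsum
  have hlim : HasPeripheralLimits (fockUCP e ω) :=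
    hasPeripheralLimits_isometryAverage hlb hl hpos hsum
  obtain ⟨m, hm, hprod, hstar⟩ := exists_modifiedChoiEffrosProduct hVtop hV hτ hlim
  refine ⟨m, hprod, fun m' h' => h'.unique hprod, ?_, hstar, fun x => ⟨fun hx => ?_, ?_⟩⟩
  · intro K _ _ _ D
    refine ⟨D.bijOn_compression hτ hVtop hV, fun z hz => D.norm_compression hτ hVtop hV hz, ?_⟩
    intro x y z hz z' hz' hzx hzy
    rw [hm, ← hzx, ← hzy]
    exact D.ultraLimit_compression_mul hτ hVtop hV hz hz'
  · refine eq_smul_one_of_ultraLimit_commute hlb hl hpos hsum hV (ultraLimit_eq_self hV hτ x.2)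
      fun y hy => ?_
    have h := congrArg Subtype.val (hx ⟨y, hy⟩)
    rw [hm, hm] at h
    exact h
  · rintro ⟨c, hc⟩ y
    exact hstar.comm_of_eq_smul_one hc y
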